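/- Let $m \ge 1$ be an integer, let $Q_m(x) = \left(\tfrac{x-i}{x+i}\right)^m$ and let $\mathbf{Q}_m = (\mathrm{Re}\,Q_m, \mathrm{Im}\,Q_m, 0) : \mathbb{R} \to \mathbb{S}^2$ be the corresponding half-harmonic map of degree $m$. Let $\mathbb{K}$ be $\mathbb{R}$ or $\mathbb{C}$, and let $\dot H^{1/2}(\mathbb{R})$ be the space of (a.e. classes of) measurable functions $f : \mathbb{R} \to \mathbb{K}$ with $\iint \frac{|f(x)-f(y)|^2}{|x-y|^2}\,dx\,dy < \infty$; it contains the constants. Consider $$L_+ = |\nabla| - \frac{2m}{1+x^2}, \qquad L_- = L_+ + R, \qquad (Rf)(x) = \frac{1}{2\pi} \int_{\mathbb{R}} \frac{|\mathbf{Q}_m(x)-\mathbf{Q}_m(y)|^2}{|x-y|^2}\, f(y)\,dy,$$ where $\widehat{|\nabla| f}(\xi) = |\xi| \hat f(\xi)$ and $L_\pm f$ is understood as a distribution (with $\langle |\nabla| f,\varphi\rangle = \int f\,|\nabla|\varphi\,dx$ for Schwartz functions $\varphi$). Let $\mathcal{N}(L_\pm) = \{ f \in \dot H^{1/2}(\mathbb{R})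 : L_\pm f = 0 \}$; an element of $\mathcal{N}(L_\pm) \setminus L^2(\mathbb{R})$ is called a resonance of $L_\pm$. For $k \ge 1$ put $$f_k(x) = \sin(k\theta) = \mathrm{Im}\,(e^{i\theta})^k, \qquad g_k(x) = \cos(k\theta) = \mathrm{Re}\,(e^{i\theta})^k, \qquad e^{i\theta} = \frac{2x + i(x^2-1)}{1+x^2},$$ so that $x = \cos\theta/(1-\sin\theta)$ (stereographic projection). Then the following holds. 1. $\mathcal{N}(L_+) = \mathrm{span}\{f_m, g_m\}$ and $\mathcal{N}(L_-) = \mathrm{span}\{1, f_1, \dots, f_m, g_1, \dots, g_m\}$ (spans over $\mathbb{K}$). 2. $\dim \mathcal{N}(L_+) = 2$ and $\dim \mathcal{N}(L_-) = 2m+1$. 3. (Nondegeneracy.) Put $\mathbf{e} = (0,0,1)$ and $J\mathbf{e} = \mathbf{Q}_m \times \mathbf{e}$. For all real-valued $h_1 \in \mathcal{N}(L_+)$ and $h_2 \in \mathcal{N}(L_-)$ the perturbation $h_1 \mathbf{e} + h_2 J\mathbf{e}$ is generated by the symmetries of the family of half-harmonic maps: there are rotations $\rho(t) \in \mathrm{SO}(3)$,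 $t\in\mathbb{R}$, differentiable at $t=0$ with $\rho(0) = \mathrm{Id}$, and points $z_1(t), \dots, z_m(t)$ in the open upper half-plane, continuous at $t=0$ with $z_1(0) = \dots = z_m(0) = i$, such that for almost every $x \in \mathbb{R}$ $$\frac{d}{dt}\Big|_{t=0}\, \rho(t)\,\big(\mathrm{Re}\,B_t(x), \mathrm{Im}\,B_t(x), 0\big) = h_1(x)\,\mathbf{e} + h_2(x)\,(J\mathbf{e})(x), \qquad B_t(x) = \prod_{k=1}^m \frac{x-z_k(t)}{x-\overline{z_k(t)}}.$$ 4. $L_+$ and $L_-$ have a common resonance $\varphi \in \dot H^{1/2}(\mathbb{R}) \setminus L^2(\mathbb{R})$, given by $\varphi = f_m$ if $m$ is odd and $\varphi = g_m$ if $m$ is even. -/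

import Mathlib

open MeasureTheory Matrix
open scoped FourierTransform Real

noncomputable section

namespace HalfHarmonic

/-! ### Half-harmonic maps with values in the equator of the unit sphere -/

/-- The map `(Re w, Im w, 0)` from the complex plane to `ℝ³`. -/
def equator (w : ℂ) : EuclideanSpace ℝ (Fin 3) := !₂[w.re, w.im, 0]

/-- The degree `m` half-harmonic map `Q_m = (Re, Im, 0)` of `((x - i)/(x + i)) ^ m`. -/
def halfHarmonicMap (m : ℕ) (x : ℝ) : EuclideanSpace ℝ (Fin 3) :=
  equator ((((x : ℂ) - Complex.I) / ((x : ℂ) + Complex.I)) ^ m)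

/-- The restriction to the real line of the finite Blaschke product with zeros `z₁, …, z_m`. -/
def blaschke {m : ℕ} (z : Fin m → ℂ) (x : ℝ) : ℂ :=
  ∏ k, ((x : ℂ) - z k) / ((x : ℂ) - (starRingEnd ℂ) (z k))

/-- The action of a `3 × 3` rotation on `ℝ³`. -/
def rotate (ρ : Matrix.specialOrthogonalGroup (Fin 3) ℝ) (v : EuclideanSpace ℝ (Fin 3)) :
    EuclideanSpace ℝ (Fin 3) :=
  WithLp.toLp 2 ((ρ : Matrix (Fin 3) (Fin 3) ℝ) *ᵥ v.ofLp)

/-- The vertical unit vector `e = (0, 0, 1)`. -/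
def frameE : EuclideanSpace ℝ (Fin 3) := !₂[0, 0, 1]

/-- The second frame vector `J e = Q_m(x) × e` of the tangent plane of the sphere at `Q_m(x)`. -/
def frameJE (m : ℕ) (x : ℝ) : EuclideanSpace ℝ (Fin 3) :=
  WithLp.toLp 2 (crossProduct (halfHarmonicMap m x).ofLp frameE.ofLp)

/-! ### The operator `|∇|` and the homogeneous Sobolev space -/

/-- The Fourier side definition of `|∇| φ` for a real-valued Schwartz function `φ`. With Mathlib's
normalisation of the Fourier transform the symbol of `|∇|` is `2π|ξ|`. -/
def absNablaFourier (φ : SchwartzMap ℝ ℝ) (x : ℝ) : ℂ :=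
  𝓕⁻ (fun ξ : ℝ => ((2 * π * |ξ| : ℝ) : ℂ) * 𝓕 (fun y : ℝ => ((φ y : ℝ) : ℂ)) ξ) x

/-- `|∇| φ` for a real-valued Schwartz function `φ`, as a real-valued function; taking the real
part loses nothing, see `absNabla_eq`. -/
def absNabla (φ : SchwartzMap ℝ ℝ) (x : ℝ) : ℝ := (absNablaFourier φ x).re

theorem absNabla_eq (φ : SchwartzMap ℝ ℝ) (x : ℝ) :
    ((absNabla φ x : ℝ) : ℂ) = absNablaFourier φ x := by
  have key : (starRingEnd ℂ) (absNablaFourier φ x) = absNablaFourier φ x := by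
    have h1 : ∀ ξ : ℝ, (starRingEnd ℂ) (𝓕 (fun y : ℝ => ((φ y : ℝ) : ℂ)) ξ)
        = 𝓕 (fun y : ℝ => ((φ y : ℝ) : ℂ)) (-ξ) := by
      intro ξ
      rw [Real.fourier_real_eq_integral_exp_smul, Real.fourier_real_eq_integral_exp_smul,
        ← integral_conj]
      congr 1
      ext y
      simp [← Complex.exp_conj, Complex.conj_ofNat]
    unfold absNablaFourier
    rw [Real.fourierInv_eq', ← integral_conj]
    rw [← integral_neg_eq_self]
    congr 1
    ext ξ
    simp [← Complex.exp_conj, Complex.conj_ofNat, h1]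
  exact Complex.conj_eq_iff_re.mp key

variable {𝕜 : Type*} [RCLike 𝕜]

/-- Membership in `Ḣ^{1/2}(ℝ)`: the class of `f` has finite energy
`∬ |f(x) - f(y)|² / |x - y|² dx dy < ∞`. Constant functions belong to this space. -/
def MemHdot (f : ℝ →ₘ[volume] 𝕜) : Prop :=
  ∫⁻ x : ℝ, ∫⁻ y : ℝ, ENNReal.ofReal (‖f x - f y‖ ^ 2 / |x - y| ^ 2) < ⊤

/-! ### The linearised operators

For `f` in `Ḣ^{1/2}(ℝ)` the function `f / (1 + x²)` is integrable, and `|∇| φ` and the kernel of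
`R` decay quadratically, so that all integrals below converge absolutely. `L_±` are the
corresponding distributions, given by their action on Schwartz functions. -/

/-- The distribution `L_+ f = |∇| f - 2m/(1+x²) f`, where `|∇|` acts on `f` by duality. -/
def opLplus (m : ℕ) (f : ℝ →ₘ[volume] 𝕜) (φ : SchwartzMap ℝ ℝ) : 𝕜 :=
  (∫ x : ℝ, absNabla φ x • f x) - ∫ x : ℝ, φ x • ((2 * (m : ℝ) / (1 + x ^ 2)) • f x)

/-- The integral operator `(R f)(x) = (1/2π) ∫ |Q_m(x) - Q_m(y)|² / |x - y|² f(y) dy`. -/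
def opR (m : ℕ) (f : ℝ →ₘ[volume] 𝕜) (x : ℝ) : 𝕜 :=
  (1 / (2 * π)) •
    ∫ y : ℝ, (‖halfHarmonicMap m x - halfHarmonicMap m y‖ ^ 2 / |x - y| ^ 2) • f y

/-- The distribution `L_- f = L_+ f + R f`. -/
def opLminus (m : ℕ) (f : ℝ →ₘ[volume] 𝕜) (φ : SchwartzMap ℝ ℝ) : 𝕜 :=
  opLplus m f φ + ∫ x : ℝ, φ x • opR m f x

variable (𝕜) in
/-- The nullspace of `L_+` in `Ḣ^{1/2}(ℝ)`. -/
def nullLplus (m : ℕ) : Set (ℝ →ₘ[volume] 𝕜) :=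
  {f | MemHdot f ∧ ∀ φ : SchwartzMap ℝ ℝ, opLplus m f φ = 0}

variable (𝕜) in
/-- The nullspace of `L_-` in `Ḣ^{1/2}(ℝ)`. -/
def nullLminus (m : ℕ) : Set (ℝ →ₘ[volume] 𝕜) :=
  {f | MemHdot f ∧ ∀ φ : SchwartzMap ℝ ℝ, opLminus m f φ = 0}

/-- A resonance is an element of a nullspace that is not square integrable. -/
def IsResonance (N : Set (ℝ →ₘ[volume] 𝕜)) (f : ℝ →ₘ[volume] 𝕜) : Prop :=
  f ∈ N ∧ ¬ MemLp f 2 volume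

/-! ### The functions `f_k` and `g_k` -/

/-- The inverse stereographic projection from the north pole: the point
`e^{iθ} = (2x + i (x² - 1)) / (1 + x²)` of the unit circle with `x = cos θ / (1 - sin θ)`. -/
def stereo (x : ℝ) : ℂ :=
  ((2 * x / (1 + x ^ 2) : ℝ) : ℂ) + (((x ^ 2 - 1) / (1 + x ^ 2) : ℝ) : ℂ) * Complex.I

theorem continuous_stereo : Continuous stereo := by
  have h : ∀ x : ℝ, 1 + x ^ 2 ≠ 0 := fun x => by positivity
  have h1 : Continuous fun x : ℝ => 2 * x / (1 + x ^ 2) :=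
    Continuous.div (by fun_prop) (by fun_prop) h
  have h2 : Continuous fun x : ℝ => (x ^ 2 - 1) / (1 + x ^ 2) :=
    Continuous.div (by fun_prop) (by fun_prop) h
  exact (Complex.continuous_ofReal.comp h1).add
    ((Complex.continuous_ofReal.comp h2).mul continuous_const)

variable (𝕜) in
/-- `f_k(x) = sin (kθ) = Im (e^{iθ})^k`. -/
def fFun (k : ℕ) : ℝ →ₘ[volume] 𝕜 :=
  AEEqFun.mk (fun x : ℝ => (((stereo x ^ k).im : ℝ) : 𝕜))
    (RCLike.continuous_ofReal.comp
      (Complex.continuous_im.comp (continuous_stereo.pow k))).aestronglyMeasurable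

variable (𝕜) in
/-- `g_k(x) = cos (kθ) = Re (e^{iθ})^k`. -/
def gFun (k : ℕ) : ℝ →ₘ[volume] 𝕜 :=
  AEEqFun.mk (fun x : ℝ => (((stereo x ^ k).re : ℝ) : 𝕜))
    (RCLike.continuous_ofReal.comp
      (Complex.continuous_re.comp (continuous_stereo.pow k))).aestronglyMeasurable

/-! ### Nondegeneracy -/

/-- Nondegeneracy of the linearised operator at `Q_m`: every perturbation `h = h₁ e + h₂ J e` with
`h₁` in the nullspace of `L_+` and `h₂` in the nullspace of `L_-` is generated by the symmetries
of the family of half-harmonic maps: it is the velocity at time `0` of a curve through `Q_m` that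
is obtained by rotating the target sphere and moving the `m` zeros of the Blaschke product in the
upper half-plane. Translations of the line are among the motions of the zeros. The
zeros are only asked to move continuously, since they collide at time `0`. -/
def Nondegenerate (m : ℕ) : Prop :=
  ∀ h₁ ∈ nullLplus ℝ m, ∀ h₂ ∈ nullLminus ℝ m,
    ∃ (ρ : ℝ → Matrix.specialOrthogonalGroup (Fin 3) ℝ) (z : ℝ → Fin m → ℂ),
      ρ 0 = 1 ∧
      (∀ i j, DifferentiableAt ℝ (fun t => (ρ t : Matrix (Fin 3) (Fin 3) ℝ) i j) 0) ∧
      (∀ k, z 0 k = Complex.I) ∧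
      (∀ t k, 0 < (z t k).im) ∧
      ContinuousAt z 0 ∧
      ∀ᵐ x : ℝ, HasDerivAt (fun t : ℝ => rotate (ρ t) (equator (blaschke (z t) x)))
        (h₁ x • frameE + h₂ x • frameJE m x) 0

end HalfHarmonic

end

open HalfHarmonic MeasureTheory

/-! The map `stereo` wraps the line onto the unit circle minus the point i, with arc length `weight
x` dx. Write z = `stereo x`. On the circle all three terms of the operators become diagonal in the
Fourier basis: |∇| is `weight` times |D_θ|, the potential is `weight` times m, and the kernel of R
is `weight x * weight y` times |(z^m - w^m)/(z - w)|², a Fejér kernel, so that R is `weight` times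
the multiplier (m - |k|)_+ (`rop_stereo_pow`). Formally L_+ has the symbol |k| - m and L_- the
symbol |k| - m + (m - |k|)_+, which vanish exactly for |k| = m and for |k| ≤ m.

The powers z^k with k ≥ 0 extend holomorphically to the upper half-plane, where |∇| is the local
operator -i d/dx. They are not Schwartz, so they are cut off by dilates of a Schwartz function with
Fourier support in the positive half-line; this support condition survives multiplication by
`stereo`. Passing to the limit gives `integral_absNabla_mul_stereo_pow`, hence that the listed
functions are null functions.

For the converse only integrability of f against `weight` is used. Testing with the cut-off z^k
directly does not pass to the limit for such f, but testing with (z - i) z^k does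
(`exists_test_functions`). If s_k is the symbol and c_k the Fourier coefficient, the outcome is
s_{k+1} c_{k+1} = i s_k c_k. Since s_m = 0, every s_k c_k vanishes (`eq_zero_of_mul_recursion`), so
c_k can survive only where s_k = 0. Uniqueness of Fourier coefficients (`ae_eq_zero_of_circleCoeff`)
then leaves a trigonometric sum, and orthogonality of the characters gives the dimensions. The
resonances have the limits Im i^m or Re i^m at infinity, nonzero in the parity chosen.

For nondegeneracy, h₁ is a real-linear function of Q_m and comes from tilting the equator. h₂ is the
real part of a polynomial of degree at most m in 1/(x - i), that is, of a constant plus q(x - i)/(x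
- i)^m with deg q < m. The constant comes from spinning the equator, and the fraction from replacing
the numerator (X - i)^m of the Blaschke product by (X - i)^m + t r(X - i) (`hasDerivAt_blaschke`,
`exists_zeros_curve`). -/

noncomputable section
namespace HalfHarmonic
open Complex Filter Topology

/-! ### The stereographic weight and the powers of `stereo` -/

/-- The density `2 / (1 + x²)` of the angular measure on the circle in the stereographic chart. -/
def weight (x : ℝ) : ℝ := 2 / (1 + x ^ 2)

theorem weight_pos (x : ℝ) : 0 < weight x := by unfold weight; positivity

theorem weight_le_two (x : ℝ) : weight x ≤ 2 := by
  unfold weight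
  rw [div_le_iff₀ (by positivity)]
  nlinarith [sq_nonneg x]

theorem continuous_weight : Continuous weight :=
  Continuous.div (by fun_prop) (by fun_prop) fun x => by positivity

theorem integrable_weight : Integrable weight := by
  have := integrable_inv_one_add_sq.const_mul 2
  simp only [← div_eq_mul_inv] at this
  exact this

theorem integral_weight : ∫ x, weight x = 2 * π := by
  simp only [weight, div_eq_mul_inv]
  rw [integral_const_mul, integral_univ_inv_one_add_sq]

theorem ofReal_add_I_ne_zero (x : ℝ) : (x : ℂ) + I ≠ 0 := by
  intro h
  have := congrArg Complex.im h
  simp at this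

theorem ofReal_sub_I_ne_zero (x : ℝ) : (x : ℂ) - I ≠ 0 := by
  intro h
  have := congrArg Complex.im h
  simp at this

theorem one_add_sq_eq (x : ℝ) : (1 + (x : ℂ) ^ 2) = (x + I) * (x - I) := by
  ring_nf
  simp
  ring

theorem stereo_eq (x : ℝ) : stereo x = I + 2 / (x + I) := by
  have h1 := ofReal_add_I_ne_zero x
  have h2 := ofReal_sub_I_ne_zero x
  unfold stereo
  push_cast
  rw [one_add_sq_eq]
  field_simp
  ring_nf
  simp
  ring

theorem stereo_eq_mul (x : ℝ) : stereo x = I * ((x - I) / (x + I)) := by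
  have h1 := ofReal_add_I_ne_zero x
  rw [stereo_eq]
  field_simp
  ring_nf
  simp
  ring

theorem stereo_sub_I (x : ℝ) : stereo x - I = 2 / (x + I) := by
  rw [stereo_eq]; ring

theorem norm_stereo (x : ℝ) : ‖stereo x‖ = 1 := by
  rw [stereo_eq_mul, norm_mul, norm_div]
  have : ‖(x : ℂ) - I‖ = ‖(x : ℂ) + I‖ := by
    rw [← Complex.norm_conj]
    simp
  rw [this, div_self (norm_ne_zero_iff.2 (ofReal_add_I_ne_zero x))]
  simp

theorem stereo_ne_zero (x : ℝ) : stereo x ≠ 0 := by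
  rw [← norm_ne_zero_iff, norm_stereo]; exact one_ne_zero

theorem conj_stereo (x : ℝ) : (starRingEnd ℂ) (stereo x) = (stereo x)⁻¹ := by
  rw [Complex.inv_def, Complex.normSq_eq_norm_sq, norm_stereo]
  simp

theorem hasDerivAt_stereo (x : ℝ) : HasDerivAt stereo (I * weight x * stereo x) x := by
  have h1 := ofReal_add_I_ne_zero x
  have h2 := ofReal_sub_I_ne_zero x
  have hx : HasDerivAt (fun y : ℝ => (y : ℂ) + I) 1 x :=
    (HasDerivAt.ofReal_comp (hasDerivAt_id x)).add_const I
  have : HasDerivAt (fun y : ℝ => I + 2 * ((y : ℂ) + I)⁻¹) (2 * (-1 / (x + I) ^ 2)) x :=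
    ((hx.inv h1).const_mul 2).const_add I
  have hs : stereo = fun y : ℝ => I + 2 * ((y : ℂ) + I)⁻¹ := by
    ext y; rw [stereo_eq, div_eq_mul_inv]
  rw [← hs] at this
  convert this using 1
  rw [stereo_eq_mul, weight]
  push_cast
  rw [one_add_sq_eq]
  field_simp
  simp

theorem hasDerivAt_stereo_pow (k : ℕ) (x : ℝ) :
    HasDerivAt (fun y => stereo y ^ k) (k * I * weight x * stereo x ^ k) x := by
  refine ((hasDerivAt_stereo x).fun_pow k).congr_deriv ?_
  rcases k with _ | k
  · simp
  · rw [Nat.add_sub_cancel]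
    push_cast
    ring

/-- Stereographic projection is conformal. Through this identity both the energy and the kernel of R
are carried over to the circle. -/
theorem norm_stereo_sub_sq (x y : ℝ) :
    ‖stereo x - stereo y‖ ^ 2 = (x - y) ^ 2 * (weight x * weight y) := by
  rw [stereo_eq, stereo_eq]
  have h1 := ofReal_add_I_ne_zero x
  have h2 := ofReal_add_I_ne_zero y
  have : I + 2 / (x + I) - (I + 2 / (y + I)) = 2 * (y - x : ℝ) / ((x + I) * (y + I)) := by
    push_cast
    field_simp
    ring
  rw [this, norm_div, norm_mul, norm_mul, div_pow, mul_pow, mul_pow, Complex.norm_real,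
    Real.norm_eq_abs, sq_abs]
  have h (t : ℝ) : ‖(t : ℂ) + I‖ ^ 2 = 1 + t ^ 2 := by
    rw [← Complex.normSq_eq_norm_sq, Complex.normSq_apply]
    simp
    ring
  rw [h, h, weight, weight]
  have hx : (1 + x ^ 2) ≠ 0 := by positivity
  have hy : (1 + y ^ 2) ≠ 0 := by positivity
  field_simp
  simp
  ring

theorem stereo_injective : Function.Injective stereo := by
  intro x y h
  have := norm_stereo_sub_sq x y
  rw [h, sub_self, norm_zero] at this
  have hw : weight x * weight y ≠ 0 := (mul_pos (weight_pos x) (weight_pos y)).ne'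
  have h0 : (x - y) ^ 2 = 0 := by
    by_contra hne
    exact (mul_ne_zero hne hw) (by rw [← this]; norm_num)
  exact sub_eq_zero.1 (pow_eq_zero_iff two_ne_zero |>.1 h0)

theorem tendsto_stereo {l : Filter ℝ} (hl : l ≤ cocompact ℝ) : Tendsto stereo l (𝓝 I) := by
  have h1 : Tendsto (fun x : ℝ => (x : ℂ) + I) l (cocompact ℂ) := by
    have h2 : Tendsto (fun x : ℝ => (x : ℂ)) (cocompact ℝ) (cocompact ℂ) :=
      Complex.isometry_ofReal.isClosedEmbedding.tendsto_cocompact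
    exact ((Homeomorph.addRight I).isClosedEmbedding.tendsto_cocompact.comp h2).mono_left hl
  have h3 := (tendsto_inv₀_cobounded (α := ℂ)).comp
    (by rwa [Metric.cobounded_eq_cocompact] : Tendsto (fun x : ℝ => (x : ℂ) + I) l
      (Bornology.cobounded ℂ))
  have h4 := (h3.const_mul 2).const_add I
  simp only [mul_zero, add_zero] at h4
  refine h4.congr fun x => ?_
  simp [stereo_eq, div_eq_mul_inv]

/-- The integrand is the derivative of `stereo ^ n / (n * I)`, which has the same limit at both ends
of the line because the circle closes up at i. -/
theorem integral_stereo_pow_mul_weight {n : ℕ} (hn : n ≠ 0) :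
    ∫ x, stereo x ^ n * weight x = 0 := by
  have hn' : (n : ℂ) ≠ 0 := Nat.cast_ne_zero.2 hn
  have hd : ∀ x, HasDerivAt (fun y => stereo y ^ n / (n * I)) (stereo x ^ n * weight x) x := by
    intro x
    refine ((hasDerivAt_stereo_pow n x).div_const (n * I)).congr_deriv ?_
    rw [div_eq_iff (mul_ne_zero hn' I_ne_zero)]
    ring
  have hi : Integrable fun x => stereo x ^ n * (weight x : ℂ) := by
    refine integrable_weight.ofReal.bdd_mul (c := 1)
      (continuous_stereo.pow n).aestronglyMeasurable (Eventually.of_forall fun x => ?_)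
    simp [norm_stereo]
  have := integral_of_hasDerivAt_of_tendsto hd hi
    (((tendsto_stereo atBot_le_cocompact).pow n).div_const _)
    (((tendsto_stereo atTop_le_cocompact).pow n).div_const _)
  rw [this, sub_self]

end HalfHarmonic
end

noncomputable section
namespace HalfHarmonic
open Complex Filter Topology

/-! ### Schwartz functions with one-sided Fourier support -/

/-- A Schwartz function belongs to the Hardy space of the upper half-plane if its Fourier
transform vanishes on the negative half-line. -/
def IsHardy (ψ : SchwartzMap ℝ ℂ) : Prop := ∀ ξ < 0, 𝓕 (ψ : ℝ → ℂ) ξ = 0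

theorem hasTemperateGrowth_inv_add_I :
    Function.HasTemperateGrowth fun x : ℝ => ((x : ℂ) + I)⁻¹ := by
  have h : (fun x : ℝ => ((x : ℂ) + I)⁻¹)
      = fun x : ℝ => ((x : ℂ) - I) * (((1 + ‖x‖ ^ 2) ^ (-1 : ℝ) : ℝ) : ℂ) := by
    ext x
    have h1 := ofReal_add_I_ne_zero x
    have h2 := ofReal_sub_I_ne_zero x
    rw [Real.rpow_neg_one, Real.norm_eq_abs, sq_abs]
    push_cast
    rw [one_add_sq_eq]
    field_simp
  rw [h]
  have h1 : Function.HasTemperateGrowth fun x : ℝ => (x : ℂ) :=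
    Function.Complex.hasTemperateGrowth_ofReal
  have h2 : Function.HasTemperateGrowth fun _ : ℝ => I := Function.HasTemperateGrowth.const I
  have h3 : Function.HasTemperateGrowth fun x : ℝ => (((1 + ‖x‖ ^ 2) ^ (-1 : ℝ) : ℝ) : ℂ) :=
    Function.Complex.hasTemperateGrowth_ofReal.comp
      (Function.hasTemperateGrowth_one_add_norm_sq_rpow ℝ (-1))
  exact (h1.sub h2).mul h3

/-- Division of a Schwartz function by `x + i`. -/
def divAddI (ψ : SchwartzMap ℝ ℂ) : SchwartzMap ℝ ℂ :=
  SchwartzMap.smulLeftCLM ℂ (fun x : ℝ => ((x : ℂ) + I)⁻¹) ψ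

theorem divAddI_apply (ψ : SchwartzMap ℝ ℂ) (x : ℝ) : divAddI ψ x = (x + I)⁻¹ * ψ x := by
  simp [divAddI, SchwartzMap.smulLeftCLM_apply_apply hasTemperateGrowth_inv_add_I]

theorem fourier_schwartz_bounded (ψ : SchwartzMap ℝ ℂ) :
    ∃ C, ∀ ξ, ‖𝓕 (ψ : ℝ → ℂ) ξ‖ ≤ C :=
  ⟨_, fun ξ => SchwartzMap.norm_le_seminorm ℝ (𝓕 ψ) ξ⟩

theorem integrable_ofReal_smul (ψ : SchwartzMap ℝ ℂ) : Integrable fun x : ℝ => x • ψ x := by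
  have h := SchwartzMap.integrable_pow_mul volume ψ 1
  have hm : AEStronglyMeasurable (fun x : ℝ => x • ψ x) volume :=
    (continuous_id.smul ψ.continuous).aestronglyMeasurable
  refine (integrable_norm_iff hm).1 (h.congr (Eventually.of_forall fun x => ?_))
  simp

theorem hasDerivAt_fourier_schwartz (ψ : SchwartzMap ℝ ℂ) (ξ : ℝ) :
    HasDerivAt (𝓕 (ψ : ℝ → ℂ)) (𝓕 (fun x : ℝ => (-2 * π * I * x) • ψ x) ξ) ξ :=
  Real.hasDerivAt_fourier ψ.integrable (integrable_ofReal_smul ψ) ξ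

/-- The pole -i lies in the lower half-plane. On the Fourier side, (x + i) g = ψ reads ĝ' = -2π ĝ on
the negative half-line, so ĝ is a multiple of exp(-2πξ) there; boundedness as ξ → -∞ forces the
multiple to be 0. -/
theorem IsHardy.divAddI {ψ : SchwartzMap ℝ ℂ} (h : IsHardy ψ) : IsHardy (divAddI ψ) := by
  intro ξ hξ
  set g := HalfHarmonic.divAddI ψ with hg
  have hxg : (fun x : ℝ => (-2 * π * I * x) • g x)
      = ((-2 * π * I) • ψ + (-2 * π) • g : SchwartzMap ℝ ℂ) := by
    ext x
    have h1 := ofReal_add_I_ne_zero x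
    have : ψ x = (x + I) * g x := by
      rw [hg, divAddI_apply, mul_inv_cancel_left₀ h1]
    simp only [_root_.add_apply, _root_.smul_apply, this, smul_eq_mul]
    simp only [real_smul]
    push_cast
    ring_nf
    simp
  have hder : ∀ w < 0, HasDerivAt (𝓕 (g : ℝ → ℂ)) (-2 * π * 𝓕 (g : ℝ → ℂ) w) w := by
    intro w hw
    refine (hasDerivAt_fourier_schwartz g w).congr_deriv ?_
    rw [hxg, ← SchwartzMap.fourier_coe, FourierTransform.fourier_add, FourierTransform.fourier_smul,
      FourierTransform.fourier_smul]
    simp only [_root_.add_apply, _root_.smul_apply, SchwartzMap.fourier_coe, h w hw]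
    simp
  have hder2 : ∀ w < 0, HasDerivAt (fun w : ℝ => cexp (2 * π * w) * 𝓕 (g : ℝ → ℂ) w) 0 w := by
    intro w hw
    have h1 : HasDerivAt (fun w : ℝ => cexp (2 * π * w)) (cexp (2 * π * w) * (2 * π * 1)) w :=
      ((HasDerivAt.ofReal_comp (hasDerivAt_id w)).const_mul (2 * π : ℂ)).cexp
    refine (h1.mul (hder w hw)).congr_deriv ?_
    ring
  have hconst : ∀ w : ℝ, w < 0 → cexp (2 * π * w) * 𝓕 (g : ℝ → ℂ) w
      = cexp (2 * π * ξ) * 𝓕 (g : ℝ → ℂ) ξ := by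
    intro w hw
    refine isOpen_Iio.is_const_of_deriv_eq_zero (s := Set.Iio (0 : ℝ))
      (f := fun w : ℝ => cexp (2 * π * w) * 𝓕 (g : ℝ → ℂ) w) isPreconnected_Iio
      (fun y hy => (hder2 y hy).differentiableAt.differentiableWithinAt)
      (fun y hy => (hder2 y hy).deriv) hw hξ
  obtain ⟨C, hC⟩ := fourier_schwartz_bounded g
  have hexp : Tendsto (fun w : ℝ => Real.exp (2 * π * w) * C) atBot (𝓝 0) := by
    have : Tendsto (fun w : ℝ => 2 * π * w) atBot atBot :=
      tendsto_id.const_mul_atBot (by positivity)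
    simpa using (Real.tendsto_exp_atBot.comp this).mul_const C
  have hlim : Tendsto (fun w : ℝ => cexp (2 * π * w) * 𝓕 (g : ℝ → ℂ) w) atBot (𝓝 0) := by
    refine squeeze_zero_norm (fun w => ?_) hexp
    rw [norm_mul, Complex.norm_exp]
    have : (2 * π * w : ℂ).re = 2 * π * w := by
      have : (2 * π * w : ℂ) = ((2 * π * w : ℝ) : ℂ) := by push_cast; ring
      rw [this, Complex.ofReal_re]
    rw [this]
    exact mul_le_mul_of_nonneg_left (hC w) (Real.exp_pos _).le
  have hlim2 : Tendsto (fun w : ℝ => cexp (2 * π * w) * 𝓕 (g : ℝ → ℂ) w) atBot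
      (𝓝 (cexp (2 * π * ξ) * 𝓕 (g : ℝ → ℂ) ξ)) := by
    refine tendsto_const_nhds.congr' ?_
    filter_upwards [eventually_lt_atBot (0 : ℝ)] with w hw
    exact (hconst w hw).symm
  have := tendsto_nhds_unique hlim2 hlim
  exact (mul_eq_zero.1 this).resolve_left (Complex.exp_ne_zero _)

theorem IsHardy.add {ψ χ : SchwartzMap ℝ ℂ} (h : IsHardy ψ) (h' : IsHardy χ) :
    IsHardy (ψ + χ) := by
  intro ξ hξ
  rw [← SchwartzMap.fourier_coe, FourierTransform.fourier_add, _root_.add_apply,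
    SchwartzMap.fourier_coe, SchwartzMap.fourier_coe, h ξ hξ, h' ξ hξ, add_zero]

theorem IsHardy.smul {ψ : SchwartzMap ℝ ℂ} (h : IsHardy ψ) (c : ℂ) : IsHardy (c • ψ) := by
  intro ξ hξ
  rw [← SchwartzMap.fourier_coe, FourierTransform.fourier_smul, _root_.smul_apply,
    SchwartzMap.fourier_coe, h ξ hξ, smul_zero]

/-- Multiplication of a Schwartz function by `stereo = i + 2 / (x + i)`. -/
def mulStereo (ψ : SchwartzMap ℝ ℂ) : SchwartzMap ℝ ℂ := I • ψ + (2 : ℂ) • divAddI ψ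

theorem mulStereo_apply (ψ : SchwartzMap ℝ ℂ) (x : ℝ) : mulStereo ψ x = stereo x * ψ x := by
  simp only [mulStereo, _root_.add_apply, _root_.smul_apply, divAddI_apply, stereo_eq,
    smul_eq_mul]
  ring

theorem IsHardy.mulStereo {ψ : SchwartzMap ℝ ℂ} (h : IsHardy ψ) : IsHardy (mulStereo ψ) :=
  (h.smul I).add (h.divAddI.smul 2)

/-- The inverse Fourier transform of a bump supported in [1/2, 3/2], divided by the integral of the
bump. -/
theorem exists_isHardy_apply_zero : ∃ η : SchwartzMap ℝ ℂ, IsHardy η ∧ η 0 = 1 := by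
  let b : ContDiffBump (1 : ℝ) := ⟨1 / 4, 1 / 2, by norm_num, by norm_num⟩
  let f : ℝ → ℂ := fun x => (b x : ℂ)
  have hf : HasCompactSupport f := b.hasCompactSupport.comp_left (g := Complex.ofReal) (by simp)
  have hf' : ContDiff ℝ (⊤ : ℕ∞) f := Complex.ofRealCLM.contDiff.comp b.contDiff
  let B : SchwartzMap ℝ ℂ := hf.toSchwartzMap hf'
  have hB : ∀ x, B x = (b x : ℂ) := fun x => rfl
  have hpos : 0 < ∫ x, b x := b.integral_pos
  have hint : ∫ x, B x = ((∫ x, b x : ℝ) : ℂ) := by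
    simp_rw [hB]; exact integral_ofReal
  have hne : (∫ x, B x) ≠ 0 := by rw [hint]; exact_mod_cast hpos.ne'
  refine ⟨(∫ x, B x)⁻¹ • 𝓕⁻ B, ?_, ?_⟩
  · intro ξ hξ
    rw [← SchwartzMap.fourier_coe, FourierTransform.fourier_smul, _root_.smul_apply,
      FourierTransform.fourier_fourierInv_eq, hB, b.zero_of_le_dist]
    · simp
    · rw [Real.dist_eq, abs_of_neg (by linarith)]
      change (1 / 2 : ℝ) ≤ _
      linarith
  · rw [_root_.smul_apply, SchwartzMap.fourierInv_coe, Real.fourierInv_eq']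
    simp only [smul_eq_mul, inner_zero_right]
    simp [hne]

theorem IsHardy.comp_smul {ψ : SchwartzMap ℝ ℂ} (h : IsHardy ψ) {c : ℝ} (hc : 0 < c) :
    ∃ χ : SchwartzMap ℝ ℂ, IsHardy χ ∧ ∀ x, χ x = ψ (c * x) := by
  let e : ℝ ≃L[ℝ] ℝ := ContinuousLinearEquiv.smulLeft (Units.mk0 c hc.ne')
  have he : ∀ x, e x = c * x := fun x => rfl
  refine ⟨SchwartzMap.compCLMOfContinuousLinearEquiv ℂ e ψ, ?_, fun x => ?_⟩
  · intro ξ hξ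
    rw [Real.fourier_real_eq_integral_exp_smul]
    have hcong : ∀ x : ℝ, cexp ((-2 * π * x * ξ : ℝ) * I)
        • (SchwartzMap.compCLMOfContinuousLinearEquiv ℂ e ψ) x
        = (fun y : ℝ => cexp ((-2 * π * y * (ξ / c) : ℝ) * I) • ψ y) (c * x) := by
      intro x
      simp only [SchwartzMap.compCLMOfContinuousLinearEquiv_apply, Function.comp, he]
      have : -2 * π * x * ξ = -2 * π * (c * x) * (ξ / c) := by field_simp
      rw [this]
    rw [integral_congr_ae (Eventually.of_forall hcong)]
    rw [Measure.integral_comp_mul_left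
      (fun y : ℝ => cexp ((-2 * π * y * (ξ / c) : ℝ) * I) • ψ y), ← Real.fourier_real_eq_integral_exp_smul,
      h _ (div_neg_of_neg_of_pos hξ hc), smul_zero]
  · simp [SchwartzMap.compCLMOfContinuousLinearEquiv_apply, he]

end HalfHarmonic
end

noncomputable section
namespace HalfHarmonic
open Complex Filter Topology

/-! ### The operator `|∇|` on Schwartz functions -/

/-- `|∇| ψ` for a complex-valued Schwartz function `ψ`. -/
def absNablaC (ψ : SchwartzMap ℝ ℂ) (x : ℝ) : ℂ :=
  𝓕⁻ (fun ξ : ℝ => ((2 * π * |ξ| : ℝ) : ℂ) * 𝓕 (ψ : ℝ → ℂ) ξ) x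

/-- A real-valued Schwartz function, seen as a complex-valued one. -/
def toComplex (φ : SchwartzMap ℝ ℝ) : SchwartzMap ℝ ℂ :=
  SchwartzMap.postcompCLM Complex.ofRealCLM φ

theorem toComplex_apply (φ : SchwartzMap ℝ ℝ) (x : ℝ) : toComplex φ x = (φ x : ℂ) := rfl

theorem absNabla_eq_absNablaC (φ : SchwartzMap ℝ ℝ) (x : ℝ) :
    ((absNabla φ x : ℝ) : ℂ) = absNablaC (toComplex φ) x := absNabla_eq φ x

/-- The real part of a complex-valued Schwartz function. -/
def rePart (ψ : SchwartzMap ℝ ℂ) : SchwartzMap ℝ ℝ := SchwartzMap.postcompCLM Complex.reCLM ψ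

/-- The imaginary part of a complex-valued Schwartz function. -/
def imPart (ψ : SchwartzMap ℝ ℂ) : SchwartzMap ℝ ℝ := SchwartzMap.postcompCLM Complex.imCLM ψ

theorem rePart_apply (ψ : SchwartzMap ℝ ℂ) (x : ℝ) : rePart ψ x = (ψ x).re := rfl

theorem imPart_apply (ψ : SchwartzMap ℝ ℂ) (x : ℝ) : imPart ψ x = (ψ x).im := rfl

theorem toComplex_rePart_add (ψ : SchwartzMap ℝ ℂ) :
    toComplex (rePart ψ) + I • toComplex (imPart ψ) = ψ := by
  ext x
  simp only [_root_.add_apply, _root_.smul_apply, toComplex_apply, rePart_apply, imPart_apply,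
    smul_eq_mul]
  rw [mul_comm, Complex.re_add_im]

theorem integrable_symbol_mul (ψ : SchwartzMap ℝ ℂ) :
    Integrable fun ξ : ℝ => ((2 * π * |ξ| : ℝ) : ℂ) * 𝓕 (ψ : ℝ → ℂ) ξ := by
  have h := (SchwartzMap.integrable_pow_mul volume (𝓕 ψ) 1).const_mul (2 * π)
  have hm : Continuous (fun ξ : ℝ => ((2 * π * |ξ| : ℝ) : ℂ) * 𝓕 (ψ : ℝ → ℂ) ξ) :=
    (Complex.continuous_ofReal.comp (by fun_prop)).mul (𝓕 ψ).continuous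
  refine (integrable_norm_iff hm.aestronglyMeasurable).1 (h.congr (Eventually.of_forall fun x => ?_))
  simp [abs_of_pos Real.pi_pos, mul_assoc, SchwartzMap.fourier_coe]

theorem absNablaC_add (ψ χ : SchwartzMap ℝ ℂ) (x : ℝ) :
    absNablaC (ψ + χ) x = absNablaC ψ x + absNablaC χ x := by
  unfold absNablaC
  have h1 := integrable_symbol_mul ψ
  have h2 := integrable_symbol_mul χ
  rw [Real.fourierInv_eq_fourier_neg, Real.fourierInv_eq_fourier_neg,
    Real.fourierInv_eq_fourier_neg, Real.fourier_eq, Real.fourier_eq, Real.fourier_eq,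
    ← integral_add ((Real.fourierIntegral_convergent_iff _).2 h1)
      ((Real.fourierIntegral_convergent_iff _).2 h2)]
  congr 1
  ext ξ
  rw [← SchwartzMap.fourier_coe, FourierTransform.fourier_add, _root_.add_apply, mul_add, smul_add]
  rfl

theorem absNablaC_smul (c : ℂ) (ψ : SchwartzMap ℝ ℂ) (x : ℝ) :
    absNablaC (c • ψ) x = c * absNablaC ψ x := by
  unfold absNablaC
  rw [Real.fourierInv_eq', Real.fourierInv_eq', ← integral_const_mul]
  congr 1
  ext ξ
  rw [← SchwartzMap.fourier_coe, FourierTransform.fourier_smul, _root_.smul_apply,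
    SchwartzMap.fourier_coe]
  simp only [smul_eq_mul]
  ring

theorem absNabla_rePart_add (ψ : SchwartzMap ℝ ℂ) (x : ℝ) :
    (absNabla (rePart ψ) x : ℂ) + I * absNabla (imPart ψ) x = absNablaC ψ x := by
  rw [absNabla_eq_absNablaC, absNabla_eq_absNablaC, ← absNablaC_smul, ← absNablaC_add,
    toComplex_rePart_add]

/-- On the Fourier support |ξ| = ξ, so the nonlocal operator |∇| coincides with -i d/dx. -/
theorem IsHardy.symbol_mul {ψ : SchwartzMap ℝ ℂ} (h : IsHardy ψ) (ξ : ℝ) :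
    ((2 * π * |ξ| : ℝ) : ℂ) * 𝓕 (ψ : ℝ → ℂ) ξ
      = 𝓕 (((-I) • SchwartzMap.derivCLM ℂ ℂ ψ : SchwartzMap ℝ ℂ) : ℝ → ℂ) ξ := by
  have hd : 𝓕 (deriv ψ) ξ = (2 * π * I * ξ) • 𝓕 (ψ : ℝ → ℂ) ξ := by
    rw [Real.fourier_deriv ψ.integrable ψ.differentiable
      (SchwartzMap.derivCLM ℂ ℂ ψ).integrable]
  have hcoe : ((SchwartzMap.derivCLM ℂ ℂ ψ : SchwartzMap ℝ ℂ) : ℝ → ℂ) = deriv ψ := by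
    ext y; exact SchwartzMap.derivCLM_apply ℂ ψ y
  have hR : 𝓕 (((-I) • SchwartzMap.derivCLM ℂ ℂ ψ : SchwartzMap ℝ ℂ) : ℝ → ℂ) ξ
      = -I * 𝓕 (deriv ψ) ξ := by
    rw [← hcoe, ← SchwartzMap.fourier_coe, FourierTransform.fourier_smul, _root_.smul_apply,
      SchwartzMap.fourier_coe, smul_eq_mul]
  rw [hR, hd]
  rcases lt_or_ge ξ 0 with hξ | hξ
  · rw [h ξ hξ]; simp
  · rw [abs_of_nonneg hξ, smul_eq_mul]
    push_cast
    ring_nf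
    simp

theorem IsHardy.absNablaC_eq {ψ : SchwartzMap ℝ ℂ} (h : IsHardy ψ) (x : ℝ) :
    absNablaC ψ x = -I * deriv ψ x := by
  unfold absNablaC
  simp_rw [h.symbol_mul]
  rw [← SchwartzMap.fourier_coe, ← SchwartzMap.fourierInv_coe,
    FourierTransform.fourierInv_fourier_eq]
  simp

/-- Symmetry of |∇|: the Fourier transform is moved onto `ψ`, and the symbol follows because it is
even. -/
theorem IsHardy.integral_absNablaC_mul {ψ : SchwartzMap ℝ ℂ} (h : IsHardy ψ)
    (φ : SchwartzMap ℝ ℂ) :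
    ∫ x, absNablaC φ x * ψ x = ∫ x, φ x * (-I * deriv ψ x) := by
  set χ : SchwartzMap ℝ ℂ := (-I) • SchwartzMap.derivCLM ℂ ℂ ψ with hχ
  have hχx : ∀ x, χ x = -I * deriv ψ x := fun x => by simp [hχ]
  set M : ℝ → ℂ := fun ξ : ℝ => ((2 * π * |ξ| : ℝ) : ℂ) * 𝓕 (φ : ℝ → ℂ) ξ with hM
  have h1 : ∫ x, absNablaC φ x * ψ x = ∫ ξ, M ξ * 𝓕⁻ (ψ : ℝ → ℂ) ξ := by
    -- The inverse transform is the Fourier integral for the pairing `-innerₗ ℝ`, which is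
    -- symmetric.
    have hflip : (-innerₗ ℝ : ℝ →ₗ[ℝ] ℝ →ₗ[ℝ] ℝ).flip = -innerₗ ℝ := by
      ext; simp
    have := VectorFourier.integral_fourierIntegral_smul_eq_flip (e := Real.fourierChar)
      (L := (-innerₗ ℝ : ℝ →ₗ[ℝ] ℝ →ₗ[ℝ] ℝ)) (μ := volume) (ν := volume)
      Real.continuous_fourierChar (by simp only [LinearMap.neg_apply, innerₗ_apply_apply]; fun_prop)
      (integrable_symbol_mul φ) ψ.integrable
    rw [hflip] at this
    exact this
  have h2 : ∀ ξ, M ξ * 𝓕⁻ (ψ : ℝ → ℂ) ξ = 𝓕 φ ξ * 𝓕⁻ χ ξ := by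
    intro ξ
    rw [SchwartzMap.fourierInv_coe, Real.fourierInv_eq_fourier_neg, Real.fourierInv_eq_fourier_neg,
      hχ, ← h.symbol_mul, abs_neg, hM, SchwartzMap.fourier_coe]
    ring
  rw [h1]
  simp_rw [h2]
  rw [← SchwartzMap.integral_fourierInv_mul_eq, FourierTransform.fourierInv_fourier_eq]
  simp_rw [hχx]

/-! ### Quadratic decay of |∇| φ. -/

/-- Integration by parts on a half-line against an oscillating exponential. -/
theorem integral_Ioi_cexp_mul (H : SchwartzMap ℝ ℂ) {t : ℝ} (ht : t ≠ 0) :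
    ∫ ξ in Set.Ioi (0 : ℝ), cexp (t * I * ξ) * H ξ
      = -(H 0 + ∫ ξ in Set.Ioi (0 : ℝ), cexp (t * I * ξ) * deriv H ξ) / (t * I) := by
  have hnorm : ∀ ξ : ℝ, ‖cexp (t * I * ξ)‖ = 1 := by
    intro ξ
    have : (t * I * ξ : ℂ) = ((t * ξ : ℝ) : ℂ) * I := by push_cast; ring
    rw [this, Complex.norm_exp_ofReal_mul_I]
  have hc : Continuous fun ξ : ℝ => cexp (t * I * ξ) := by fun_prop
  have hint : ∀ K : SchwartzMap ℝ ℂ, Integrable fun ξ : ℝ => cexp (t * I * ξ) * K ξ := fun K =>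
    K.integrable.bdd_mul (c := 1) hc.aestronglyMeasurable
      (Eventually.of_forall fun ξ => (hnorm ξ).le)
  have hi1 := hint H
  have hi2 : Integrable fun ξ : ℝ => cexp (t * I * ξ) * deriv H ξ := by
    simpa using hint (SchwartzMap.derivCLM ℂ ℂ H)
  have hd : ∀ ξ : ℝ, HasDerivAt (fun ξ : ℝ => cexp (t * I * ξ) * H ξ)
      (t * I * (cexp (t * I * ξ) * H ξ) + cexp (t * I * ξ) * deriv H ξ) ξ := by
    intro ξ
    have h1 : HasDerivAt (fun w : ℝ => cexp (t * I * w)) (cexp (t * I * ξ) * (t * I * 1)) ξ :=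
      ((HasDerivAt.ofReal_comp (hasDerivAt_id ξ)).const_mul (t * I : ℂ)).cexp
    refine (h1.mul (H.hasDerivAt ξ)).congr_deriv ?_
    ring
  have hlim : Tendsto (fun ξ : ℝ => cexp (t * I * ξ) * H ξ) atTop (𝓝 0) := by
    refine tendsto_zero_iff_norm_tendsto_zero.2 ?_
    have := (H.tendsto_cocompact.mono_left atTop_le_cocompact).norm
    rw [norm_zero] at this
    exact this.congr fun ξ => by rw [norm_mul, hnorm, one_mul]
  have key := integral_Ioi_of_hasDerivAt_of_tendsto (a := (0 : ℝ))
    (hd 0).continuousAt.continuousWithinAt (fun ξ _ => hd ξ)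
    ((hi1.const_mul (t * I)).add hi2).integrableOn hlim
  rw [integral_add (hi1.const_mul (t * I)).integrableOn hi2.integrableOn,
    integral_const_mul] at key
  have hne : (t * I : ℂ) ≠ 0 := mul_ne_zero (by exact_mod_cast ht) I_ne_zero
  rw [eq_div_iff hne]
  simp only [ofReal_zero, mul_zero, Complex.exp_zero, one_mul] at key
  linear_combination key

/-- Two integrations by parts; the first boundary term vanishes because `K 0 = 0`, so the decay is
of order t⁻² instead of t⁻¹. -/
theorem exists_norm_integral_Ioi_cexp_mul_le (K : SchwartzMap ℝ ℂ) (hK : K 0 = 0) :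
    ∃ C, ∀ t : ℝ, t ≠ 0 → ‖∫ ξ in Set.Ioi (0 : ℝ), cexp (t * I * ξ) * K ξ‖ * t ^ 2 ≤ C := by
  set K' := SchwartzMap.derivCLM ℂ ℂ K
  refine ⟨‖K' 0‖ + ∫ ξ in Set.Ioi (0 : ℝ), ‖deriv K' ξ‖, fun t ht => ?_⟩
  have hK' : ∀ ξ, deriv K ξ = K' ξ := fun ξ => (SchwartzMap.derivCLM_apply ℂ K ξ).symm
  have hne : (t * I : ℂ) ≠ 0 := mul_ne_zero (by exact_mod_cast ht) I_ne_zero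
  have ht2 : ‖(t * I : ℂ)‖ ^ 2 = t ^ 2 := by simp
  rw [integral_Ioi_cexp_mul K ht, hK, zero_add]
  simp_rw [hK']
  rw [integral_Ioi_cexp_mul K' ht, ← ht2, ← norm_pow, ← norm_mul]
  have : -(-(K' 0 + ∫ ξ in Set.Ioi (0 : ℝ), cexp (t * I * ξ) * deriv K' ξ) / (t * I)) / (t * I)
      * (t * I) ^ 2 = K' 0 + ∫ ξ in Set.Ioi (0 : ℝ), cexp (t * I * ξ) * deriv K' ξ := by
    rw [neg_div, neg_div, neg_div, neg_neg, div_div, ← sq, div_mul_cancel₀ _ (pow_ne_zero 2 hne)]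
  rw [this]
  refine (norm_add_le _ _).trans (add_le_add le_rfl ((norm_integral_le_integral_norm _).trans ?_))
  refine le_of_eq (integral_congr_ae (Eventually.of_forall fun ξ => ?_))
  have : (t * I * ξ : ℂ) = ((t * ξ : ℝ) : ℂ) * I := by push_cast; ring
  simp only [norm_mul]
  rw [this, Complex.norm_exp_ofReal_mul_I, one_mul]

/-- The symbol |ξ| has a kink at 0 but vanishes there. On each half-line it agrees with a smooth
function, so the preceding estimate applies to both halves separately. This bound is what lets |∇| φ
be paired with every function integrable against `weight`. -/
theorem exists_norm_absNablaC_le (φ : SchwartzMap ℝ ℂ) :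
    ∃ C, ∀ x, ‖absNablaC φ x‖ ≤ C * weight x := by
  have hg : Function.HasTemperateGrowth fun ξ : ℝ => ((2 * π * ξ : ℝ) : ℂ) :=
    Function.Complex.hasTemperateGrowth_ofReal.comp (by fun_prop)
  set K₁ : SchwartzMap ℝ ℂ := SchwartzMap.smulLeftCLM ℂ (fun ξ : ℝ => ((2 * π * ξ : ℝ) : ℂ)) (𝓕 φ)
    with hK₁
  set K₂ : SchwartzMap ℝ ℂ := SchwartzMap.smulLeftCLM ℂ (fun ξ : ℝ => ((2 * π * ξ : ℝ) : ℂ))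
    (𝓕⁻ φ) with hK₂
  have hK₁x : ∀ ξ, K₁ ξ = ((2 * π * ξ : ℝ) : ℂ) * 𝓕 (φ : ℝ → ℂ) ξ := fun ξ => by
    rw [hK₁, SchwartzMap.smulLeftCLM_apply_apply hg, smul_eq_mul, SchwartzMap.fourier_coe]
  have hK₂x : ∀ ξ, K₂ ξ = ((2 * π * ξ : ℝ) : ℂ) * 𝓕 (φ : ℝ → ℂ) (-ξ) := fun ξ => by
    rw [hK₂, SchwartzMap.smulLeftCLM_apply_apply hg, smul_eq_mul, SchwartzMap.fourierInv_coe,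
      Real.fourierInv_eq_fourier_neg]
  obtain ⟨C₁, hC₁⟩ := exists_norm_integral_Ioi_cexp_mul_le K₁ (by simp [hK₁x])
  obtain ⟨C₂, hC₂⟩ := exists_norm_integral_Ioi_cexp_mul_le K₂ (by simp [hK₂x])
  set M : ℝ → ℂ := fun ξ : ℝ => ((2 * π * |ξ| : ℝ) : ℂ) * 𝓕 (φ : ℝ → ℂ) ξ with hM
  have hMi : Integrable M := integrable_symbol_mul φ
  have heq : ∀ x, absNablaC φ x = ∫ ξ : ℝ, cexp ((2 * π * x : ℝ) * I * ξ) * M ξ := by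
    intro x
    unfold absNablaC
    rw [Real.fourierInv_eq']
    congr 1
    ext ξ
    simp only [smul_eq_mul, hM, RCLike.inner_apply, conj_trivial]
    congr 2
    push_cast
    ring
  have hnorm : ∀ t ξ : ℝ, ‖cexp (t * I * ξ)‖ = 1 := by
    intro t ξ
    have : (t * I * ξ : ℂ) = ((t * ξ : ℝ) : ℂ) * I := by push_cast; ring
    rw [this, Complex.norm_exp_ofReal_mul_I]
  have hi : ∀ x : ℝ, Integrable fun ξ : ℝ => cexp ((2 * π * x : ℝ) * I * ξ) * M ξ := fun x =>
    hMi.bdd_mul (c := 1) (by fun_prop) (Eventually.of_forall fun ξ => (hnorm _ ξ).le)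
  have hbd : ∀ x, ‖absNablaC φ x‖ ≤ ∫ ξ, ‖M ξ‖ := by
    intro x
    rw [heq]
    refine (norm_integral_le_integral_norm _).trans
      (le_of_eq (integral_congr_ae (Eventually.of_forall fun ξ => ?_)))
    simp only [norm_mul, hnorm, one_mul]
  have hsq : ∀ x, ‖absNablaC φ x‖ * x ^ 2 ≤ (C₁ + C₂) / (2 * π) ^ 2 := by
    intro x
    have hC : 0 ≤ C₁ + C₂ := add_nonneg ((by positivity : (0 : ℝ) ≤ _).trans (hC₁ 1 one_ne_zero))
      ((by positivity : (0 : ℝ) ≤ _).trans (hC₂ 1 one_ne_zero))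
    rcases eq_or_ne x 0 with rfl | hx
    · simp only [ne_eq, OfNat.ofNat_ne_zero, not_false_eq_true, zero_pow, mul_zero]
      positivity
    have ht : 2 * π * x ≠ 0 := mul_ne_zero (by positivity) hx
    have h1 := hC₁ _ ht
    have h2 := hC₂ _ (neg_ne_zero.2 ht)
    -- The negative half-line is reflected to the positive one, which turns the frequency 2πx into
    -- -2πx and the transform of `φ` into its inverse transform.
    have hsplit : absNablaC φ x
        = (∫ ξ in Set.Ioi (0 : ℝ), cexp (((-(2 * π * x) : ℝ) : ℂ) * I * ξ) * K₂ ξ)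
          + ∫ ξ in Set.Ioi (0 : ℝ), cexp ((2 * π * x : ℝ) * I * ξ) * K₁ ξ := by
      rw [heq, ← integral_add_compl (measurableSet_Iic (a := (0 : ℝ))) (hi x), Set.compl_Iic]
      congr 1
      · have hneg := integral_comp_neg_Ioi (0 : ℝ)
          fun ξ : ℝ => cexp ((2 * π * x : ℝ) * I * ξ) * M ξ
        rw [neg_zero] at hneg
        rw [← hneg]
        refine setIntegral_congr_fun measurableSet_Ioi fun ξ hξ => ?_
        have : |(-ξ)| = ξ := by rw [abs_neg, abs_of_pos (by simpa using hξ)]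
        simp only [hM, hK₂x, this]
        congr 2
        push_cast
        ring
      · refine setIntegral_congr_fun measurableSet_Ioi fun ξ hξ => ?_
        have : |ξ| = ξ := abs_of_pos hξ
        simp only [hM, hK₁x, this]
    rw [le_div_iff₀ (by positivity), mul_assoc, ← mul_pow, mul_comm x, hsplit]
    rw [neg_sq] at h2
    calc _ ≤ _ := mul_le_mul_of_nonneg_right (norm_add_le _ _) (sq_nonneg _)
      _ ≤ C₁ + C₂ := by rw [add_mul]; linarith
  refine ⟨((∫ ξ, ‖M ξ‖) + (C₁ + C₂) / (2 * π) ^ 2) / 2, fun x => ?_⟩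
  have hpos : (0 : ℝ) < 1 + x ^ 2 := by positivity
  rw [weight, div_mul_div_comm, mul_comm (2 : ℝ) (1 + x ^ 2), mul_div_mul_right _ _ two_ne_zero,
    le_div_iff₀ hpos, mul_add, mul_one]
  exact add_le_add (hbd x) (hsq x)

theorem continuous_absNablaC (φ : SchwartzMap ℝ ℂ) : Continuous (absNablaC φ) := by
  have : absNablaC φ = fun x => 𝓕 (fun ξ : ℝ => ((2 * π * |ξ| : ℝ) : ℂ) * 𝓕 (φ : ℝ → ℂ) ξ) (-x) := by
    ext x
    exact Real.fourierInv_eq_fourier_neg _ _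
  rw [this]
  exact (VectorFourier.fourierIntegral_continuous Real.continuous_fourierChar
    (by simp only [innerₗ_apply_apply]; fun_prop) (integrable_symbol_mul φ)).comp continuous_neg

theorem exists_abs_absNabla_le (φ : SchwartzMap ℝ ℝ) :
    ∃ C, ∀ x, |absNabla φ x| ≤ C * weight x := by
  obtain ⟨C, hC⟩ := exists_norm_absNablaC_le (toComplex φ)
  refine ⟨C, fun x => ?_⟩
  have := hC x
  rwa [← absNabla_eq_absNablaC, Complex.norm_real] at this

theorem continuous_absNabla (φ : SchwartzMap ℝ ℝ) : Continuous (absNabla φ) := by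
  have : absNabla φ = fun x => (absNablaC (toComplex φ) x).re := by
    ext x
    rw [← absNabla_eq_absNablaC, Complex.ofReal_re]
  rw [this]
  exact Complex.continuous_re.comp (continuous_absNablaC _)

end HalfHarmonic
end

noncomputable section
namespace HalfHarmonic
open Complex Filter Topology

/-! ### The linearised operators on functions of tempered size -/

variable {E F : Type*} [NormedAddCommGroup E] [NormedSpace ℝ E]
  [NormedAddCommGroup F] [NormedSpace ℝ F]

/-- Functions that are integrable for the angular measure `2 dx / (1 + x²)`. -/
def AngularIntegrable (f : ℝ → E) : Prop := Integrable fun x => weight x • f x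

/-- The distribution `L_+ f` for a function `f`. -/
def lplus (m : ℕ) (f : ℝ → E) (φ : SchwartzMap ℝ ℝ) : E :=
  (∫ x : ℝ, absNabla φ x • f x) - ∫ x : ℝ, φ x • ((2 * (m : ℝ) / (1 + x ^ 2)) • f x)

/-- The kernel of the operator `R`, without the factor `1 / 2π`. -/
def kernelR (m : ℕ) (x y : ℝ) : ℝ :=
  ‖halfHarmonicMap m x - halfHarmonicMap m y‖ ^ 2 / |x - y| ^ 2

/-- The function `R f` for a function `f`. -/
def rop (m : ℕ) (f : ℝ → E) (x : ℝ) : E := (1 / (2 * π)) • ∫ y : ℝ, kernelR m x y • f y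

/-- The distribution `L_- f` for a function `f`. -/
def lminus (m : ℕ) (f : ℝ → E) (φ : SchwartzMap ℝ ℝ) : E :=
  lplus m f φ + ∫ x : ℝ, φ x • rop m f x

theorem opLplus_eq {𝕜 : Type*} [RCLike 𝕜] (m : ℕ) (f : ℝ →ₘ[volume] 𝕜) (φ : SchwartzMap ℝ ℝ) :
    opLplus m f φ = lplus m f φ := rfl

theorem opLminus_eq {𝕜 : Type*} [RCLike 𝕜] (m : ℕ) (f : ℝ →ₘ[volume] 𝕜) (φ : SchwartzMap ℝ ℝ) :
    opLminus m f φ = lminus m f φ := rfl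

theorem lplus_congr {f g : ℝ → E} (h : f =ᵐ[volume] g) (m : ℕ) (φ : SchwartzMap ℝ ℝ) :
    lplus m f φ = lplus m g φ := by
  unfold lplus
  congr 1
  · exact integral_congr_ae (h.mono fun x hx => by simp only [hx])
  · exact integral_congr_ae (h.mono fun x hx => by simp only [hx])

theorem rop_congr {f g : ℝ → E} (h : f =ᵐ[volume] g) (m : ℕ) (x : ℝ) : rop m f x = rop m g x := by
  unfold rop
  congr 1
  exact integral_congr_ae (h.mono fun x hx => by simp only [hx])

theorem lminus_congr {f g : ℝ → E} (h : f =ᵐ[volume] g) (m : ℕ) (φ : SchwartzMap ℝ ℝ) :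
    lminus m f φ = lminus m g φ := by
  unfold lminus
  simp_rw [lplus_congr h, rop_congr h]

theorem two_mul_div_eq (m : ℕ) (x : ℝ) : 2 * (m : ℝ) / (1 + x ^ 2) = m * weight x := by
  unfold weight; ring

theorem AngularIntegrable.aestronglyMeasurable {f : ℝ → E} (hf : AngularIntegrable f) :
    AEStronglyMeasurable f volume := by
  have h : f = fun x => (weight x)⁻¹ • (weight x • f x) := by
    ext x
    rw [inv_smul_smul₀ (weight_pos x).ne']
  rw [h]
  exact (continuous_weight.inv₀ fun x => (weight_pos x).ne').aestronglyMeasurable.smul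
    (Integrable.aestronglyMeasurable hf)

theorem AngularIntegrable.smul_of_bound {f : ℝ → E} (hf : AngularIntegrable f) {a : ℝ → ℝ}
    (ha : AEStronglyMeasurable a volume) {C : ℝ} (h : ∀ x, |a x| ≤ C * weight x) :
    Integrable fun x => a x • f x := by
  refine Integrable.mono' (Integrable.norm hf |>.const_mul C) (ha.smul hf.aestronglyMeasurable)
    (Eventually.of_forall fun x => ?_)
  rw [norm_smul, norm_smul, Real.norm_eq_abs, Real.norm_of_nonneg (weight_pos x).le, ← mul_assoc]
  exact mul_le_mul_of_nonneg_right (h x) (norm_nonneg _)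

theorem AngularIntegrable.absNabla_smul {f : ℝ → E} (hf : AngularIntegrable f)
    (φ : SchwartzMap ℝ ℝ) : Integrable fun x => absNabla φ x • f x := by
  obtain ⟨C, hC⟩ := exists_abs_absNabla_le φ
  exact hf.smul_of_bound (continuous_absNabla φ).aestronglyMeasurable hC

theorem AngularIntegrable.potential_smul {f : ℝ → E} (hf : AngularIntegrable f) (m : ℕ)
    (φ : SchwartzMap ℝ ℝ) :
    Integrable fun x => φ x • ((2 * (m : ℝ) / (1 + x ^ 2)) • f x) := by
  simp_rw [two_mul_div_eq, smul_smul]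
  refine hf.smul_of_bound (C := SchwartzMap.seminorm ℝ 0 0 φ * m)
    (φ.continuous.mul (continuous_const.mul continuous_weight)).aestronglyMeasurable fun x => ?_
  rw [abs_mul, abs_mul, abs_of_pos (weight_pos x), Nat.abs_cast, mul_assoc]
  exact mul_le_mul_of_nonneg_right (φ.norm_le_seminorm ℝ x)
    (mul_nonneg (Nat.cast_nonneg m) (weight_pos x).le)

theorem halfHarmonicMap_sub_norm (m : ℕ) (x y : ℝ) :
    ‖halfHarmonicMap m x - halfHarmonicMap m y‖ = ‖stereo x ^ m - stereo y ^ m‖ := by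
  have h : ∀ a b : ℂ, ‖equator a - equator b‖ = ‖a - b‖ := by
    intro a b
    rw [EuclideanSpace.norm_eq, Fin.sum_univ_three, Complex.norm_eq_sqrt_sq_add_sq]
    simp [equator]
  unfold halfHarmonicMap
  rw [h, stereo_eq_mul, stereo_eq_mul, mul_pow, mul_pow, ← mul_sub, norm_mul, norm_pow]
  simp

/-- Factor z^m - w^m by z - w; the chord length cancels the singular denominator. The diagonal is
excluded because there `kernelR` is 0 by the convention for division by zero. -/
theorem kernelR_eq (m : ℕ) {x y : ℝ} (h : x ≠ y) :
    kernelR m x y = weight x * weight y *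
      ‖∑ j ∈ Finset.range m, stereo x ^ j * stereo y ^ (m - 1 - j)‖ ^ 2 := by
  rw [kernelR, halfHarmonicMap_sub_norm, ← (Commute.all (stereo x) (stereo y)).geom_sum₂_mul,
    norm_mul, mul_pow, norm_stereo_sub_sq, sq_abs]
  have : (x - y) ^ 2 ≠ 0 := pow_ne_zero 2 (sub_ne_zero.2 h)
  field_simp

theorem kernelR_le (m : ℕ) (x y : ℝ) : kernelR m x y ≤ (m : ℝ) ^ 2 * (weight x * weight y) := by
  rcases eq_or_ne x y with rfl | h
  · have := mul_pos (weight_pos x) (weight_pos x)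
    simp only [kernelR, sub_self, abs_zero, norm_zero]
    rw [zero_pow two_ne_zero, zero_div]
    positivity
  · rw [kernelR_eq m h, mul_comm]
    refine mul_le_mul_of_nonneg_right ?_ (mul_pos (weight_pos x) (weight_pos y)).le
    refine pow_le_pow_left₀ (norm_nonneg _) ?_ 2
    refine (norm_sum_le _ _).trans ?_
    simp [norm_stereo]

theorem kernelR_nonneg (m : ℕ) (x y : ℝ) : 0 ≤ kernelR m x y := by
  unfold kernelR; positivity

theorem continuous_halfHarmonicMap (m : ℕ) : Continuous (halfHarmonicMap m) := by
  have h : Continuous fun x : ℝ => (((x : ℂ) - I) / ((x : ℂ) + I)) ^ m :=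
    ((Complex.continuous_ofReal.sub continuous_const).div
      (Complex.continuous_ofReal.add continuous_const) ofReal_add_I_ne_zero).pow m
  unfold halfHarmonicMap equator
  refine (PiLp.continuous_toLp 2 _).comp (continuous_pi fun i => ?_)
  fin_cases i
  · exact Complex.continuous_re.comp h
  · exact Complex.continuous_im.comp h
  · exact continuous_const

theorem measurable_kernelR (m : ℕ) : Measurable fun p : ℝ × ℝ => kernelR m p.1 p.2 := by
  have h1 : Continuous fun p : ℝ × ℝ =>
      ‖halfHarmonicMap m p.1 - halfHarmonicMap m p.2‖ ^ 2 := by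
    have := continuous_halfHarmonicMap m
    fun_prop
  have h2 : Continuous fun p : ℝ × ℝ => |p.1 - p.2| ^ 2 := by fun_prop
  exact h1.measurable.div h2.measurable

theorem AngularIntegrable.kernelR_smul {f : ℝ → E} (hf : AngularIntegrable f) (m : ℕ) (x : ℝ) :
    Integrable fun y => kernelR m x y • f y := by
  refine hf.smul_of_bound (C := (m : ℝ) ^ 2 * weight x)
    ((measurable_kernelR m).comp measurable_prodMk_left).aestronglyMeasurable fun y => ?_
  rw [abs_of_nonneg (kernelR_nonneg m x y), mul_assoc]
  exact kernelR_le m x y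

theorem AngularIntegrable.norm_rop_le {f : ℝ → E} (hf : AngularIntegrable f) (m : ℕ) :
    ∃ C, ∀ x, ‖rop m f x‖ ≤ C * weight x := by
  refine ⟨1 / (2 * π) * ((m : ℝ) ^ 2 * ∫ y, ‖weight y • f y‖), fun x => ?_⟩
  unfold rop
  rw [norm_smul, Real.norm_of_nonneg (by positivity), mul_assoc]
  refine mul_le_mul_of_nonneg_left ?_ (by positivity)
  calc ‖∫ y, kernelR m x y • f y‖ ≤ ∫ y, ‖kernelR m x y • f y‖ := norm_integral_le_integral_norm _
    _ ≤ ∫ y, (m : ℝ) ^ 2 * weight x * ‖weight y • f y‖ := by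
        refine integral_mono (hf.kernelR_smul m x).norm (Integrable.norm hf |>.const_mul _)
          fun y => ?_
        simp only [norm_smul, Real.norm_of_nonneg (weight_pos y).le,
          Real.norm_of_nonneg (kernelR_nonneg m x y)]
        rw [← mul_assoc]
        refine mul_le_mul_of_nonneg_right ?_ (norm_nonneg _)
        rw [mul_assoc]
        exact kernelR_le m x y
    _ = (m : ℝ) ^ 2 * (∫ y, ‖weight y • f y‖) * weight x := by
        rw [integral_const_mul]; ring

theorem AngularIntegrable.aestronglyMeasurable_rop {f : ℝ → E} (hf : AngularIntegrable f)
    (m : ℕ) : AEStronglyMeasurable (rop m f) volume := by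
  unfold rop
  refine AEStronglyMeasurable.const_smul ?_ _
  exact ((measurable_kernelR m).aestronglyMeasurable.smul
    hf.aestronglyMeasurable.comp_snd).integral_prod_right'

theorem AngularIntegrable.smul_rop {f : ℝ → E} (hf : AngularIntegrable f) (m : ℕ)
    (φ : SchwartzMap ℝ ℝ) : Integrable fun x => φ x • rop m f x := by
  obtain ⟨C, hC⟩ := hf.norm_rop_le m
  have h : Integrable (rop m f) := Integrable.mono' (integrable_weight.const_mul C)
    (hf.aestronglyMeasurable_rop m) (Eventually.of_forall hC)
  exact h.bdd_smul (SchwartzMap.seminorm ℝ 0 0 φ) φ.continuous.aestronglyMeasurable (Eventually.of_forall (φ.norm_le_seminorm ℝ))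

theorem AngularIntegrable.clm_comp {f : ℝ → E} (hf : AngularIntegrable f) (T : E →L[ℝ] F) :
    AngularIntegrable fun x => T (f x) := by
  have := T.integrable_comp hf
  simp only [map_smul] at this
  exact this

theorem AngularIntegrable.add {f g : ℝ → E} (hf : AngularIntegrable f) (hg : AngularIntegrable g) :
    AngularIntegrable fun x => f x + g x := by
  have := Integrable.add hf hg
  refine this.congr (Eventually.of_forall fun x => ?_)
  simp

theorem lplus_add {f g : ℝ → E} (hf : AngularIntegrable f) (hg : AngularIntegrable g) (m : ℕ)
    (φ : SchwartzMap ℝ ℝ) : lplus m (fun x => f x + g x) φ = lplus m f φ + lplus m g φ := by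
  unfold lplus
  simp only [smul_add]
  rw [integral_add (hf.absNabla_smul φ) (hg.absNabla_smul φ),
    integral_add (hf.potential_smul m φ) (hg.potential_smul m φ)]
  abel

theorem rop_add {f g : ℝ → E} (hf : AngularIntegrable f) (hg : AngularIntegrable g) (m : ℕ)
    (x : ℝ) : rop m (fun x => f x + g x) x = rop m f x + rop m g x := by
  unfold rop
  simp only [smul_add]
  rw [integral_add (hf.kernelR_smul m x) (hg.kernelR_smul m x), smul_add]

theorem lminus_add {f g : ℝ → E} (hf : AngularIntegrable f) (hg : AngularIntegrable g) (m : ℕ)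
    (φ : SchwartzMap ℝ ℝ) : lminus m (fun x => f x + g x) φ = lminus m f φ + lminus m g φ := by
  unfold lminus
  simp only [lplus_add hf hg, rop_add hf hg, smul_add]
  rw [integral_add (hf.smul_rop m φ) (hg.smul_rop m φ)]
  abel

variable [CompleteSpace E] [CompleteSpace F]

/-- Real-linear maps are used in three ways: to split `𝕜`-valued functions into real and imaginary
parts, to view real functions as complex ones, and to obtain `fFun` and `gFun` from `stereo ^ k`. -/
theorem AngularIntegrable.map_lplus {f : ℝ → E} (hf : AngularIntegrable f) (T : E →L[ℝ] F)
    (m : ℕ) (φ : SchwartzMap ℝ ℝ) : T (lplus m f φ) = lplus m (fun x => T (f x)) φ := by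
  unfold lplus
  rw [map_sub, ← T.integral_comp_comm (hf.absNabla_smul φ),
    ← T.integral_comp_comm (hf.potential_smul m φ)]
  simp only [map_smul]

theorem AngularIntegrable.map_rop {f : ℝ → E} (hf : AngularIntegrable f) (T : E →L[ℝ] F)
    (m : ℕ) (x : ℝ) : T (rop m f x) = rop m (fun x => T (f x)) x := by
  unfold rop
  rw [map_smul, ← T.integral_comp_comm (hf.kernelR_smul m x)]
  simp only [map_smul]

theorem AngularIntegrable.map_lminus {f : ℝ → E} (hf : AngularIntegrable f) (T : E →L[ℝ] F)
    (m : ℕ) (φ : SchwartzMap ℝ ℝ) : T (lminus m f φ) = lminus m (fun x => T (f x)) φ := by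
  unfold lminus
  rw [map_add, hf.map_lplus, ← T.integral_comp_comm (hf.smul_rop m φ)]
  simp only [map_smul, hf.map_rop]

end HalfHarmonic
end

noncomputable section
namespace HalfHarmonic
open Complex Filter Topology

/-! ### Fourier coefficients on the circle -/

/-- The Fourier coefficient `∫ e^{ipθ} F dθ` in the stereographic chart. -/
def circleCoeff (F : ℝ → ℂ) (p : ℤ) : ℂ := ∫ x, stereo x ^ p * (weight x * F x)

theorem norm_stereo_zpow (p : ℤ) (x : ℝ) : ‖stereo x ^ p‖ = 1 := by
  rw [norm_zpow, norm_stereo, _root_.one_zpow]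

theorem continuous_stereo_zpow (p : ℤ) : Continuous fun x => stereo x ^ p :=
  continuous_stereo.zpow₀ p fun x => Or.inl (stereo_ne_zero x)

theorem conj_stereo_zpow (p : ℤ) (x : ℝ) : (starRingEnd ℂ) (stereo x ^ p) = stereo x ^ (-p) := by
  rw [map_zpow₀, conj_stereo, _root_.inv_zpow, _root_.zpow_neg]

theorem integral_stereo_zpow_mul_weight (p : ℤ) :
    ∫ x, stereo x ^ p * weight x = if p = 0 then 2 * (π : ℂ) else 0 := by
  split_ifs with hp
  · subst hp
    simp only [zpow_zero, one_mul]
    rw [integral_complex_ofReal, integral_weight]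
    push_cast
    rfl
  · obtain ⟨n, rfl | rfl⟩ := p.eq_nat_or_neg
    · simp only [zpow_natCast]
      exact integral_stereo_pow_mul_weight (by exact_mod_cast hp)
    · have hn : n ≠ 0 := by rintro rfl; simp at hp
      have h := integral_stereo_pow_mul_weight hn
      have h2 := congrArg (starRingEnd ℂ) h
      rw [← integral_conj] at h2
      simp only [map_mul, map_pow, conj_stereo, Complex.conj_ofReal, map_zero] at h2
      rw [← h2]
      congr 1
      ext x
      rw [_root_.zpow_neg, zpow_natCast, inv_pow]

theorem integrable_stereo_zpow_mul {G : ℝ → ℂ} (hG : Integrable G) (p : ℤ) :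
    Integrable fun x => stereo x ^ p * G x :=
  hG.bdd_mul (c := 1) (continuous_stereo_zpow p).aestronglyMeasurable
    (Eventually.of_forall fun x => (norm_stereo_zpow p x).le)

theorem AngularIntegrable.weight_mul {U : ℝ → ℂ} (hU : AngularIntegrable U) :
    Integrable fun x => (weight x : ℂ) * U x := by
  simpa only [AngularIntegrable, real_smul] using hU

theorem AngularIntegrable.stereo_zpow {U : ℝ → ℂ} (hU : AngularIntegrable U) (p : ℤ) :
    Integrable fun x => stereo x ^ p * (weight x * U x) :=
  integrable_stereo_zpow_mul hU.weight_mul p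

theorem kernelR_eq_sum (m : ℕ) {x y : ℝ} (h : x ≠ y) :
    (kernelR m x y : ℂ) = weight x * weight y * ∑ j ∈ Finset.range m, ∑ l ∈ Finset.range m,
      stereo x ^ ((j : ℤ) - l) * stereo y ^ ((l : ℤ) - j) := by
  have hz : ∀ (t : ℝ) (a b : ℕ), stereo t ^ a * (starRingEnd ℂ) (stereo t ^ b)
      = stereo t ^ ((a : ℤ) - b) := by
    intro t a b
    rw [map_pow, conj_stereo, zpow_sub₀ (stereo_ne_zero t), zpow_natCast, zpow_natCast, inv_pow,
      div_eq_mul_inv]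
  rw [kernelR_eq m h, ← Complex.normSq_eq_norm_sq]
  push_cast
  rw [Complex.normSq_eq_conj_mul_self, mul_comm ((starRingEnd ℂ) _), map_sum, Finset.sum_mul_sum]
  congr 1
  refine Finset.sum_congr rfl fun j hj => Finset.sum_congr rfl fun l hl => ?_
  rw [Finset.mem_range] at hj hl
  rw [map_mul, mul_mul_mul_comm, hz, hz]
  congr 2
  omega

/-- The expanded kernel is a finite sum of products of characters, so R has finite rank and sees
only coefficients of index less than m in absolute value. -/
theorem rop_eq_sum {U : ℝ → ℂ} (hU : AngularIntegrable U) (m : ℕ) (x : ℝ) :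
    rop m U x = weight x * (1 / (2 * π)) * ∑ j ∈ Finset.range m, ∑ l ∈ Finset.range m,
      stereo x ^ ((j : ℤ) - l) * circleCoeff U ((l : ℤ) - j) := by
  have h1 : ∫ y, kernelR m x y • U y = ∫ y, ∑ j ∈ Finset.range m, ∑ l ∈ Finset.range m,
      weight x * stereo x ^ ((j : ℤ) - l) * (stereo y ^ ((l : ℤ) - j) * (weight y * U y)) := by
    refine integral_congr_ae ?_
    have hne : ∀ᵐ y : ℝ, y ≠ x := by simp [ae_iff, measure_singleton]
    filter_upwards [hne] with y hy
    rw [real_smul, kernelR_eq_sum m hy.symm, Finset.mul_sum, Finset.sum_mul]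
    refine Finset.sum_congr rfl fun j _ => ?_
    rw [Finset.mul_sum, Finset.sum_mul]
    refine Finset.sum_congr rfl fun l _ => ?_
    ring
  unfold rop
  rw [h1, integral_finsetSum _ fun j _ => integrable_finsetSum _ fun l _ =>
    (hU.stereo_zpow _).const_mul _]
  simp_rw [integral_finsetSum _ fun l _ => (hU.stereo_zpow _).const_mul _, integral_const_mul]
  rw [real_smul]
  push_cast
  simp_rw [mul_assoc, ← Finset.mul_sum]
  rw [← mul_assoc, ← mul_assoc, mul_comm (1 / (2 * (π : ℂ)))]
  rfl

/-- There are m - k pairs (j, l) in the square with l - j = k. The truncated subtraction is meant: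
it yields the Fejér weight (m - k)_+. -/
theorem sum_sum_ite_eq (m k : ℕ) (c : ℤ → ℂ) :
    ∑ j ∈ Finset.range m, ∑ l ∈ Finset.range m,
      (if (k : ℤ) + (j - l) = 0 then c (l - j) else 0) = (m - k : ℕ) * c k := by
  have h1 : ∀ j ∈ Finset.range m, ∑ l ∈ Finset.range m,
      (if (k : ℤ) + (j - l) = 0 then c (l - j) else 0) = if j + k < m then c k else 0 := by
    intro j _
    have : ∀ l ∈ Finset.range m, (if (k : ℤ) + (j - l) = 0 then c (l - j) else 0)
        = if l = j + k then c k else 0 := by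
      intro l _
      by_cases hl : l = j + k
      · subst hl
        rw [if_pos (by push_cast; ring), if_pos rfl]
        congr 1
        push_cast
        ring
      · rw [if_neg (by omega), if_neg hl]
    rw [Finset.sum_congr rfl this, Finset.sum_ite_eq']
    simp
  rw [Finset.sum_congr rfl h1, ← Finset.sum_filter, Finset.sum_const, nsmul_eq_mul]
  congr 2
  have : Finset.filter (fun j => j + k < m) (Finset.range m) = Finset.range (m - k) := by
    ext j
    simp only [Finset.mem_filter, Finset.mem_range]
    omega
  rw [this, Finset.card_range]

theorem integral_stereo_pow_mul_rop {U : ℝ → ℂ} (hU : AngularIntegrable U) (m k : ℕ) :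
    ∫ x, stereo x ^ k * rop m U x = (m - k : ℕ) * circleCoeff U k := by
  have h1 : ∀ x, stereo x ^ k * rop m U x = ∑ j ∈ Finset.range m, ∑ l ∈ Finset.range m,
      (1 / (2 * π)) * circleCoeff U ((l : ℤ) - j)
        * (stereo x ^ ((k : ℤ) + (j - l)) * weight x) := by
    intro x
    rw [rop_eq_sum hU, ← mul_assoc, Finset.mul_sum]
    refine Finset.sum_congr rfl fun j _ => ?_
    rw [Finset.mul_sum]
    refine Finset.sum_congr rfl fun l _ => ?_
    rw [zpow_add₀ (stereo_ne_zero x), zpow_natCast]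
    ring
  simp_rw [h1]
  have hi : ∀ p : ℤ, Integrable fun x => stereo x ^ p * (weight x : ℂ) := fun p =>
    integrable_stereo_zpow_mul integrable_weight.ofReal p
  rw [integral_finsetSum _ fun j _ => integrable_finsetSum _ fun l _ => (hi _).const_mul _]
  simp_rw [integral_finsetSum _ fun l _ => (hi _).const_mul _, integral_const_mul,
    integral_stereo_zpow_mul_weight]
  rw [← sum_sum_ite_eq]
  refine Finset.sum_congr rfl fun j _ => Finset.sum_congr rfl fun l _ => ?_
  split_ifs
  · have : (π : ℂ) ≠ 0 := by exact_mod_cast Real.pi_ne_zero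
    field_simp
  · simp

theorem circleCoeff_stereo_pow (k : ℕ) (p : ℤ) :
    circleCoeff (fun x => stereo x ^ k) p = if (k : ℤ) + p = 0 then 2 * (π : ℂ) else 0 := by
  rw [← integral_stereo_zpow_mul_weight]
  unfold circleCoeff
  congr 1
  ext x
  rw [zpow_add₀ (stereo_ne_zero x), zpow_natCast]
  ring

theorem AngularIntegrable.of_bounded {E : Type*} [NormedAddCommGroup E] [NormedSpace ℝ E]
    {f : ℝ → E} (hf : AEStronglyMeasurable f volume) {C : ℝ} (hC : ∀ x, ‖f x‖ ≤ C) :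
    AngularIntegrable f :=
  integrable_weight.smul_bdd C hf (Eventually.of_forall hC)

theorem angularIntegrable_stereo_pow (k : ℕ) : AngularIntegrable fun x => stereo x ^ k :=
  .of_bounded (C := 1) (continuous_stereo.pow k).aestronglyMeasurable fun x => by
    simp [norm_stereo]

theorem rop_stereo_pow (m k : ℕ) (x : ℝ) :
    rop m (fun x => stereo x ^ k) x = (m - k : ℕ) * (weight x * stereo x ^ k) := by
  rw [rop_eq_sum (angularIntegrable_stereo_pow k)]
  simp_rw [circleCoeff_stereo_pow]
  rw [Finset.sum_comm, Finset.mul_sum]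
  have h := sum_sum_ite_eq m k fun p => (weight x : ℂ) * stereo x ^ p
  simp only [zpow_natCast] at h
  rw [← h]
  refine Finset.sum_congr rfl fun j _ => ?_
  rw [Finset.mul_sum]
  refine Finset.sum_congr rfl fun l _ => ?_
  split_ifs
  · have : (π : ℂ) ≠ 0 := by exact_mod_cast Real.pi_ne_zero
    field_simp
  · simp

end HalfHarmonic
end

noncomputable section
namespace HalfHarmonic
open Complex Filter Topology

/-! ### Approximation of the powers of `stereo` by Hardy functions -/

/-- The dilates η(x/(n+1)) of one Hardy function with η(0) = 1. The bound on (1 + |x|) |η_n'| is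
uniform because x η_n'(x) is scale invariant; it gives one power of decay only, less than `weight`.
-/
theorem exists_isHardy_approximation : ∃ (η : ℕ → SchwartzMap ℝ ℂ) (C : ℝ), 0 ≤ C ∧
    (∀ n, IsHardy (η n)) ∧ (∀ n x, ‖η n x‖ ≤ C) ∧ (∀ n x, ‖deriv (η n) x‖ * (1 + |x|) ≤ C) ∧
    (∀ x, Tendsto (fun n => η n x) atTop (𝓝 1)) ∧
    ∀ x, Tendsto (fun n => deriv (η n) x) atTop (𝓝 0) := by
  obtain ⟨η, hη, hη0⟩ := exists_isHardy_apply_zero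
  have hc : ∀ n : ℕ, (0 : ℝ) < 1 / ((n : ℝ) + 1) := fun n => by positivity
  choose χ hχ hχx using fun n : ℕ => hη.comp_smul (hc n)
  have hcl : Tendsto (fun n : ℕ => 1 / ((n : ℝ) + 1)) atTop (𝓝 0) :=
    tendsto_one_div_add_atTop_nhds_zero_nat
  have hder : ∀ n x, deriv (χ n) x
      = (1 / ((n : ℝ) + 1)) • deriv η (1 / ((n : ℝ) + 1) * x) := by
    intro n x
    have h1 : (χ n : ℝ → ℂ) = fun x => η (1 / ((n : ℝ) + 1) * x) := funext (hχx n)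
    rw [h1, deriv_comp_mul_left]
  set η' := SchwartzMap.derivCLM ℂ ℂ η
  have hη' : ∀ x, deriv η x = η' x := fun x => (SchwartzMap.derivCLM_apply ℂ η x).symm
  set C₀ := SchwartzMap.seminorm ℝ 0 0 η
  set C₁ := SchwartzMap.seminorm ℝ 0 0 η'
  set C₂ := SchwartzMap.seminorm ℝ 1 0 η'
  have h0 : 0 ≤ C₀ := apply_nonneg _ _
  have h1 : 0 ≤ C₁ := apply_nonneg _ _
  have h2 : 0 ≤ C₂ := apply_nonneg _ _
  refine ⟨χ, C₀ + C₁ + C₂, by positivity, hχ, fun n x => ?_, fun n x => ?_, fun x => ?_,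
    fun x => ?_⟩
  · rw [hχx]
    have := η.norm_le_seminorm ℝ (1 / ((n : ℝ) + 1) * x)
    linarith
  · rw [hder, hη', norm_smul, Real.norm_of_nonneg (hc n).le]
    set c := 1 / ((n : ℝ) + 1)
    have hc1 : c ≤ 1 := by
      rw [div_le_one (by positivity)]
      have : (0 : ℝ) ≤ n := Nat.cast_nonneg n
      linarith
    have hb1 := η'.norm_le_seminorm ℝ (c * x)
    have hb2 := η'.norm_pow_mul_le_seminorm ℝ 1 (c * x)
    rw [pow_one, norm_mul, Real.norm_of_nonneg (hc n).le, Real.norm_eq_abs] at hb2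
    have hb3 : c * ‖η' (c * x)‖ ≤ 1 * ‖η' (c * x)‖ :=
      mul_le_mul_of_nonneg_right hc1 (norm_nonneg _)
    calc c * ‖η' (c * x)‖ * (1 + |x|) = c * ‖η' (c * x)‖ + c * |x| * ‖η' (c * x)‖ := by ring
      _ ≤ C₁ + C₂ := by
          refine add_le_add ?_ hb2
          linarith
      _ ≤ _ := by linarith
  · simp_rw [hχx]
    rw [← hη0]
    refine η.continuous.continuousAt.tendsto.comp ?_
    simpa using hcl.mul_const x
  · simp_rw [hder, hη']
    have h1 : Tendsto (fun n : ℕ => η' (1 / ((n : ℝ) + 1) * x)) atTop (𝓝 (η' (0 * x))) :=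
      η'.continuous.continuousAt.tendsto.comp (hcl.mul_const x)
    simpa using hcl.smul h1

/-- Multiplication of a Schwartz function by `stereo ^ k`. -/
def mulStereoPow (k : ℕ) (ψ : SchwartzMap ℝ ℂ) : SchwartzMap ℝ ℂ := mulStereo^[k] ψ

theorem mulStereoPow_apply (k : ℕ) (ψ : SchwartzMap ℝ ℂ) (x : ℝ) :
    mulStereoPow k ψ x = stereo x ^ k * ψ x := by
  induction k with
  | zero => simp [mulStereoPow]
  | succ k ih =>
    rw [mulStereoPow, Function.iterate_succ_apply', mulStereo_apply, ← mulStereoPow, ih, pow_succ]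
    ring

theorem IsHardy.mulStereoPow {ψ : SchwartzMap ℝ ℂ} (h : IsHardy ψ) (k : ℕ) :
    IsHardy (mulStereoPow k ψ) := by
  induction k with
  | zero => exact h
  | succ k ih =>
    rw [HalfHarmonic.mulStereoPow, Function.iterate_succ_apply', ← HalfHarmonic.mulStereoPow]
    exact ih.mulStereo

theorem deriv_mulStereoPow (k : ℕ) (ψ : SchwartzMap ℝ ℂ) (x : ℝ) :
    deriv (mulStereoPow k ψ) x
      = k * I * weight x * stereo x ^ k * ψ x + stereo x ^ k * deriv ψ x := by
  have : (mulStereoPow k ψ : ℝ → ℂ) = fun x => stereo x ^ k * ψ x :=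
    funext (mulStereoPow_apply k ψ)
  rw [this]
  exact ((hasDerivAt_stereo_pow k x).mul (ψ.hasDerivAt x)).deriv

/-- The powers of `stereo` are generalised eigenfunctions of `|∇|`. -/
theorem integral_absNabla_mul_stereo_pow (φ : SchwartzMap ℝ ℝ) (k : ℕ) :
    ∫ x, (absNabla φ x : ℂ) * stereo x ^ k
      = ∫ x, (φ x : ℂ) * (k * (weight x * stereo x ^ k)) := by
  obtain ⟨η, C, hC0, hη, hηC, hη'C, hη1, hη'0⟩ := exists_isHardy_approximation
  have hs : ∀ x, ‖stereo x ^ k‖ = 1 := fun x => by simp [norm_stereo]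
  -- For the cut-off power |∇| is -i d/dx; the derivative falling on `stereo ^ k` produces the
  -- eigenvalue k times `weight`, and the other term disappears in the limit.
  have heq : ∀ n, ∫ x, (absNabla φ x : ℂ) * (stereo x ^ k * η n x)
      = ∫ x, (φ x : ℂ) * (k * weight x * (stereo x ^ k * η n x)
        - I * (stereo x ^ k * deriv (η n) x)) := by
    intro n
    have := ((hη n).mulStereoPow k).integral_absNablaC_mul (toComplex φ)
    simp_rw [← absNabla_eq_absNablaC, mulStereoPow_apply, deriv_mulStereoPow, toComplex_apply]
      at this
    rw [this]
    congr 1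
    ext x
    linear_combination (-(φ x) * k * weight x * stereo x ^ k * η n x : ℂ) * I_mul_I
  have hφ : Integrable fun x => (φ x : ℂ) := (toComplex φ).integrable
  have hN : Integrable fun x => (absNabla φ x : ℂ) := by
    have : AngularIntegrable fun _ : ℝ => (1 : ℂ) :=
      .of_bounded (C := 1) aestronglyMeasurable_const fun x => by simp
    simpa using this.absNabla_smul φ
  have hder : ∀ n, Continuous (deriv (η n)) := fun n => by
    have : deriv (η n) = SchwartzMap.derivCLM ℂ ℂ (η n) := by
      ext x; exact (SchwartzMap.derivCLM_apply ℂ (η n) x).symm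
    rw [this]
    exact SchwartzMap.continuous _
  have hsc : Continuous fun x => stereo x ^ k := continuous_stereo.pow k
  have hw : Continuous fun x => (weight x : ℂ) := Complex.continuous_ofReal.comp continuous_weight
  have hl1 : Tendsto (fun n => ∫ x, (absNabla φ x : ℂ) * (stereo x ^ k * η n x)) atTop
      (𝓝 (∫ x, (absNabla φ x : ℂ) * (stereo x ^ k * 1))) := by
    refine tendsto_integral_of_dominated_convergence (fun x => ‖(absNabla φ x : ℂ)‖ * C)
      (fun n => hN.aestronglyMeasurable.mul (hsc.mul (η n).continuous).aestronglyMeasurable)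
      (hN.norm.mul_const C) (fun n => Eventually.of_forall fun x => ?_)
      (Eventually.of_forall fun x => ((hη1 x).const_mul _).const_mul _)
    rw [norm_mul, norm_mul, hs, one_mul]
    exact mul_le_mul_of_nonneg_left (hηC n x) (norm_nonneg _)
  have hl2 : Tendsto (fun n => ∫ x, (φ x : ℂ) * (k * weight x * (stereo x ^ k * η n x)
        - I * (stereo x ^ k * deriv (η n) x))) atTop
      (𝓝 (∫ x, (φ x : ℂ) * (k * weight x * (stereo x ^ k * 1)
        - I * (stereo x ^ k * 0)))) := by
    refine tendsto_integral_of_dominated_convergence (fun x => ‖(φ x : ℂ)‖ * (k * 2 * C + C))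
      (fun n => hφ.aestronglyMeasurable.mul
        (((continuous_const.mul hw).mul (hsc.mul (η n).continuous)).sub
          (continuous_const.mul (hsc.mul (hder n)))).aestronglyMeasurable)
      (hφ.norm.mul_const _) (fun n => Eventually.of_forall fun x => ?_)
      (Eventually.of_forall fun x => ((((hη1 x).const_mul _).const_mul _).sub
        (((hη'0 x).const_mul _).const_mul _)).const_mul _)
    rw [norm_mul]
    refine mul_le_mul_of_nonneg_left ((norm_sub_le _ _).trans (add_le_add ?_ ?_)) (norm_nonneg _)
    · rw [norm_mul, norm_mul, norm_mul, hs, one_mul, Complex.norm_natCast, Complex.norm_real,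
        Real.norm_of_nonneg (weight_pos x).le]
      gcongr
      · exact weight_le_two x
      · exact hηC n x
    · rw [norm_mul, norm_mul, hs, one_mul, Complex.norm_I, one_mul]
      refine le_trans ?_ (hη'C n x)
      exact le_mul_of_one_le_right (norm_nonneg _) (by linarith [abs_nonneg x])
  simp_rw [heq] at hl1
  have := tendsto_nhds_unique hl1 hl2
  simp only [mul_one, mul_zero, sub_zero] at this
  rw [this]
  congr 1
  ext x
  ring

theorem lplus_stereo_pow (m k : ℕ) (φ : SchwartzMap ℝ ℝ) :
    lplus m (fun x => stereo x ^ k) φ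
      = ((k : ℂ) - m) * ∫ x, (φ x : ℂ) * (weight x * stereo x ^ k) := by
  unfold lplus
  simp only [two_mul_div_eq, real_smul]
  rw [integral_absNabla_mul_stereo_pow, sub_mul, ← integral_const_mul, ← integral_const_mul]
  congr 1
  · congr 1
    ext x
    ring
  · congr 1
    ext x
    push_cast
    ring

theorem lminus_stereo_pow (m k : ℕ) (φ : SchwartzMap ℝ ℝ) :
    lminus m (fun x => stereo x ^ k) φ
      = ((k : ℂ) - m + (m - k : ℕ)) * ∫ x, (φ x : ℂ) * (weight x * stereo x ^ k) := by
  unfold lminus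
  simp only [lplus_stereo_pow, rop_stereo_pow, real_smul]
  rw [add_mul, ← integral_const_mul (((m - k : ℕ) : ℂ))]
  congr 2
  ext x
  ring

/-! ### The recursion for the Fourier coefficients of a null function -/

/-- Supplies the power of decay that the derivative of the cut-off lacks for domination by `weight`.
-/
theorem norm_stereo_sub_I_le (x : ℝ) : ‖stereo x - I‖ ≤ weight x * (1 + |x|) := by
  have h (t : ℝ) : ‖(t : ℂ) + I‖ ^ 2 = 1 + t ^ 2 := by
    rw [← Complex.normSq_eq_norm_sq, Complex.normSq_apply]
    simp
    ring
  have hpos : 0 < ‖(x : ℂ) + I‖ := norm_pos_iff.2 (ofReal_add_I_ne_zero x)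
  rw [stereo_sub_I, norm_div, weight, ← h, div_mul_eq_mul_div, div_le_div_iff₀ hpos (by positivity)]
  have : ‖(x : ℂ) + I‖ ≤ 1 + |x| := by
    refine (norm_add_le _ _).trans ?_
    rw [Complex.norm_real, Complex.norm_I, Real.norm_eq_abs, add_comm]
  rw [sq, Complex.norm_ofNat]
  nlinarith

/-- The distributions are tested on real Schwartz functions, whereas Hardy functions are complex;
for real `u` the two parts of the test function recombine. -/
theorem ofReal_lplus_rePart_add {u : ℝ → ℝ} (hu : AngularIntegrable u) (m : ℕ)
    (ψ : SchwartzMap ℝ ℂ) :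
    ((lplus m u (rePart ψ) : ℝ) : ℂ) + I * ((lplus m u (imPart ψ) : ℝ) : ℂ)
      = (∫ x, absNablaC ψ x * u x) - ∫ x, ψ x * (m * (weight x * u x)) := by
  have hU := hu.clm_comp Complex.ofRealCLM
  have h1 : ∀ φ, ((lplus m u φ : ℝ) : ℂ)
      = (∫ x, (absNabla φ x : ℂ) * u x) - ∫ x, (φ x : ℂ) * (m * (weight x * u x)) := by
    intro φ
    have := hu.map_lplus Complex.ofRealCLM m φ
    simp only [Complex.ofRealCLM_apply] at this
    rw [this, lplus]
    simp only [real_smul, two_mul_div_eq]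
    push_cast
    simp only [mul_assoc]
  have hi1 : ∀ φ, Integrable fun x => (absNabla φ x : ℂ) * u x := fun φ => by
    simpa using hU.absNabla_smul φ
  have hi2 : ∀ φ : SchwartzMap ℝ ℝ, Integrable fun x => (φ x : ℂ) * (m * (weight x * u x)) :=
    fun φ => by
      have := hU.potential_smul m φ
      simpa only [Complex.ofRealCLM_apply, real_smul, two_mul_div_eq, ofReal_mul, ofReal_natCast,
        mul_assoc] using this
  rw [h1, h1, mul_sub, sub_add_sub_comm, ← integral_const_mul I, ← integral_const_mul I,
    ← integral_add (hi1 _) ((hi1 _).const_mul I), ← integral_add (hi2 _) ((hi2 _).const_mul I)]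
  congr 1
  · congr 1
    ext x
    rw [← absNabla_rePart_add]
    ring
  · congr 1
    ext x
    conv_rhs => rw [← Complex.re_add_im (ψ x)]
    rw [rePart_apply, imPart_apply]
    ring

theorem ofReal_lminus_rePart_add {u : ℝ → ℝ} (hu : AngularIntegrable u) (m : ℕ)
    (ψ : SchwartzMap ℝ ℂ) :
    ((lminus m u (rePart ψ) : ℝ) : ℂ) + I * ((lminus m u (imPart ψ) : ℝ) : ℂ)
      = (∫ x, absNablaC ψ x * u x) - (∫ x, ψ x * (m * (weight x * u x)))
        + ∫ x, ψ x * rop m (fun x => (u x : ℂ)) x := by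
  have hU := hu.clm_comp Complex.ofRealCLM
  have h1 : ∀ φ : SchwartzMap ℝ ℝ, ((∫ x, φ x • rop m u x : ℝ) : ℂ)
      = ∫ x, (φ x : ℂ) * rop m (fun x => (u x : ℂ)) x := by
    intro φ
    rw [← integral_complex_ofReal]
    congr 1
    ext x
    have := hu.map_rop Complex.ofRealCLM m x
    simp only [Complex.ofRealCLM_apply] at this
    rw [← this, smul_eq_mul, ofReal_mul]
  have hi : ∀ φ : SchwartzMap ℝ ℝ,
      Integrable fun x => (φ x : ℂ) * rop m (fun x => (u x : ℂ)) x := fun φ => by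
    simpa using hU.smul_rop m φ
  rw [← ofReal_lplus_rePart_add hu, lminus, lminus, ofReal_add, ofReal_add, h1, h1, mul_add,
    add_add_add_comm, ← integral_const_mul I, ← integral_add (hi _) ((hi _).const_mul I)]
  congr 2
  ext x
  conv_rhs => rw [← Complex.re_add_im (ψ x)]
  rw [rePart_apply, imPart_apply]
  ring

/-- Hardy test functions that exhaust `(stereo - i) stereo ^ k`, whose decay makes all limits
dominated. -/
theorem exists_test_functions {U : ℝ → ℂ} (hU : AngularIntegrable U) (k : ℕ) :
    ∃ ψ : ℕ → SchwartzMap ℝ ℂ,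
      Tendsto (fun n => ∫ x, absNablaC (ψ n) x * U x) atTop
        (𝓝 ((k + 1 : ℕ) * circleCoeff U (k + 1 : ℕ) - I * (k * circleCoeff U k))) ∧
      ∀ G : ℝ → ℂ, Integrable G → Tendsto (fun n => ∫ x, ψ n x * G x) atTop
        (𝓝 ((∫ x, stereo x ^ (k + 1) * G x) - I * ∫ x, stereo x ^ k * G x)) := by
  obtain ⟨η, C, hC0, hη, hηC, hη'C, hη1, hη'0⟩ := exists_isHardy_approximation
  have hs : ∀ x (k : ℕ), ‖stereo x ^ k‖ = 1 := fun x => by simp [norm_stereo]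
  have hsc : ∀ k : ℕ, Continuous fun x => stereo x ^ k := fun k => continuous_stereo.pow k
  have hint : ∀ G : ℝ → ℂ, Integrable G → ∀ j : ℕ, Integrable fun x => stereo x ^ j * G x :=
    fun G hG j => hG.bdd_mul (c := 1) (hsc j).aestronglyMeasurable
      (Eventually.of_forall fun x => (hs x j).le)
  -- This is (z - i) z^k times the cut-off. The factor z - i vanishes at infinity; its price is that
  -- consecutive Fourier coefficients become coupled.
  set ψ : ℕ → SchwartzMap ℝ ℂ := fun n =>
    mulStereoPow (k + 1) (η n) + (-I) • mulStereoPow k (η n) with hψ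
  have hψx : ∀ n x, ψ n x = (stereo x ^ (k + 1) - I * stereo x ^ k) * η n x := by
    intro n x
    simp only [hψ, _root_.add_apply, _root_.smul_apply, mulStereoPow_apply, smul_eq_mul]
    ring
  have hH : ∀ n, IsHardy (ψ n) := fun n =>
    ((hη n).mulStereoPow _).add (((hη n).mulStereoPow _).smul _)
  have hder : ∀ n x, absNablaC (ψ n) x
      = ((k + 1 : ℕ) * stereo x ^ (k + 1) - I * (k * stereo x ^ k)) * weight x * η n x
        - I * ((stereo x - I) * (stereo x ^ k * deriv (η n) x)) := by
    intro n x
    have hd : HasDerivAt (ψ n) (deriv (mulStereoPow (k + 1) (η n)) x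
        + -I * deriv (mulStereoPow k (η n)) x) x :=
      ((mulStereoPow (k + 1) (η n)).hasDerivAt x).add
        (((mulStereoPow k (η n)).hasDerivAt x).const_mul (-I))
    rw [(hH n).absNablaC_eq, hd.deriv, deriv_mulStereoPow, deriv_mulStereoPow]
    linear_combination (-((k + 1 : ℕ) * stereo x ^ (k + 1) - I * (k * stereo x ^ k))
      * weight x * η n x : ℂ) * I_mul_I
  refine ⟨ψ, ?_, fun G hG => ?_⟩
  · have hlim : ((k + 1 : ℕ) * circleCoeff U (k + 1 : ℕ) - I * (k * circleCoeff U k))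
        = ∫ x, (((k + 1 : ℕ) * stereo x ^ (k + 1) - I * (k * stereo x ^ k)) * weight x * 1
          - I * ((stereo x - I) * (stereo x ^ k * 0))) * U x := by
      unfold circleCoeff
      simp only [zpow_natCast]
      rw [← integral_const_mul, ← integral_const_mul, ← integral_const_mul,
        ← integral_sub ((hint _ hU.weight_mul _).const_mul _)
          (((hint _ hU.weight_mul _).const_mul _).const_mul _)]
      congr 1
      ext x
      ring
    rw [hlim]
    simp_rw [hder]
    have hmeas : ∀ n, Continuous fun x => absNablaC (ψ n) x := fun n => continuous_absNablaC _
    simp_rw [hder] at hmeas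
    refine tendsto_integral_of_dominated_convergence
      (fun x => ((k + 1 : ℕ) + k + 1 : ℝ) * C * ‖(weight x : ℂ) * U x‖)
      (fun n => (hmeas n).aestronglyMeasurable.mul hU.aestronglyMeasurable)
      (hU.weight_mul.norm.const_mul _) (fun n => Eventually.of_forall fun x => ?_)
      (Eventually.of_forall fun x => ?_)
    · have hw : ‖(weight x : ℂ)‖ = weight x := by
        rw [Complex.norm_real, Real.norm_of_nonneg (weight_pos x).le]
      rw [norm_mul, norm_mul (weight x : ℂ), hw, ← mul_assoc (((k + 1 : ℕ) + k + 1 : ℝ) * C)]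
      refine mul_le_mul_of_nonneg_right ?_ (norm_nonneg (U x))
      have e1 : ‖((k + 1 : ℕ) * stereo x ^ (k + 1) - I * (k * stereo x ^ k) : ℂ)‖
          ≤ (k + 1 : ℕ) + k := by
        refine (norm_sub_le _ _).trans (le_of_eq ?_)
        rw [norm_mul, norm_mul, norm_mul, hs, hs, Complex.norm_I, Complex.norm_natCast,
          Complex.norm_natCast]
        ring
      -- Without the factor `stereo x - I` this term would be bounded by C / (1 + |x|) only, which
      -- need not be integrable against `U`.
      have e2 : ‖stereo x - I‖ * ‖deriv (η n) x‖ ≤ weight x * C := by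
        calc ‖stereo x - I‖ * ‖deriv (η n) x‖
            ≤ weight x * (1 + |x|) * ‖deriv (η n) x‖ :=
              mul_le_mul_of_nonneg_right (norm_stereo_sub_I_le x) (norm_nonneg _)
          _ = weight x * (‖deriv (η n) x‖ * (1 + |x|)) := by ring
          _ ≤ weight x * C := mul_le_mul_of_nonneg_left (hη'C n x) (weight_pos x).le
      refine (norm_sub_le _ _).trans ?_
      rw [norm_mul, norm_mul, norm_mul I, norm_mul, norm_mul (stereo x ^ k), hs, Complex.norm_I,
        one_mul, one_mul, hw]
      have e3 := mul_le_mul_of_nonneg_right e1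
        (mul_nonneg (weight_pos x).le hC0)
      have e4 : ‖((k + 1 : ℕ) * stereo x ^ (k + 1) - I * (k * stereo x ^ k) : ℂ)‖ * weight x
          * ‖η n x‖ ≤ ‖((k + 1 : ℕ) * stereo x ^ (k + 1) - I * (k * stereo x ^ k) : ℂ)‖
            * (weight x * C) := by
        rw [mul_assoc]
        exact mul_le_mul_of_nonneg_left
          (mul_le_mul_of_nonneg_left (hηC n x) (weight_pos x).le) (norm_nonneg _)
      linarith
    · exact (((hη1 x).const_mul _).sub ((((hη'0 x).const_mul _).const_mul _).const_mul _)).mul_const _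
  · have hlim : (∫ x, stereo x ^ (k + 1) * G x) - I * ∫ x, stereo x ^ k * G x
        = ∫ x, (stereo x ^ (k + 1) - I * stereo x ^ k) * 1 * G x := by
      rw [← integral_const_mul, ← integral_sub (hint _ hG _) ((hint _ hG _).const_mul _)]
      congr 1
      ext x
      ring
    rw [hlim]
    simp_rw [hψx]
    have hmeas : ∀ n, Continuous fun x => ψ n x := fun n => (ψ n).continuous
    simp_rw [hψx] at hmeas
    refine tendsto_integral_of_dominated_convergence (fun x => 2 * C * ‖G x‖)
      (fun n => (hmeas n).aestronglyMeasurable.mul hG.aestronglyMeasurable)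
      (hG.norm.const_mul _) (fun n => Eventually.of_forall fun x => ?_)
      (Eventually.of_forall fun x => ((hη1 x).const_mul _).mul_const _)
    rw [norm_mul, norm_mul]
    refine mul_le_mul_of_nonneg_right ?_ (norm_nonneg _)
    refine mul_le_mul ((norm_sub_le _ _).trans (le_of_eq ?_)) (hηC n x) (norm_nonneg _)
      zero_le_two
    rw [norm_mul, hs, hs, Complex.norm_I]
    norm_num

/-- Applied to symbol times Fourier coefficient. The symbol vanishes at m, and the zero propagates
upwards and, since i is invertible, downwards. -/
theorem eq_zero_of_mul_recursion {a : ℕ → ℂ} {m : ℕ} (hm : a m = 0)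
    (h : ∀ k, a (k + 1) - I * a k = 0) (k : ℕ) : a k = 0 := by
  rcases le_total m k with hk | hk
  · induction k, hk using Nat.le_induction with
    | base => exact hm
    | succ k _ ih => simpa [ih] using h k
  · induction hk using Nat.decreasingInduction with
    | self => exact hm
    | of_succ k _ ih => simpa [ih] using h k

theorem circleCoeff_eq_zero_of_lplus {u : ℝ → ℝ} (hu : AngularIntegrable u) {m : ℕ}
    (h : ∀ φ, lplus m u φ = 0) {k : ℕ} (hk : k ≠ m) :
    circleCoeff (fun x => (u x : ℂ)) k = 0 := by
  have hU : AngularIntegrable fun x => (u x : ℂ) := hu.clm_comp Complex.ofRealCLM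
  have key : ∀ k : ℕ, ((k : ℂ) - m) * circleCoeff (fun x => (u x : ℂ)) k = 0 := by
    refine eq_zero_of_mul_recursion (m := m) (by simp) fun k => ?_
    obtain ⟨ψ, h1, h2⟩ := exists_test_functions hU k
    have h3 := h1.sub (h2 _ (hU.weight_mul.const_mul (m : ℂ)))
    have h4 : ∀ n, (∫ x, absNablaC (ψ n) x * u x) - ∫ x, ψ n x * (m * (weight x * u x)) = 0 := by
      intro n
      rw [← ofReal_lplus_rePart_add hu, h, h]
      simp
    have h5 := tendsto_nhds_unique h3 (by simp_rw [h4]; exact tendsto_const_nhds)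
    rw [← h5]
    simp_rw [mul_left_comm _ (m : ℂ), integral_const_mul]
    simp only [circleCoeff, zpow_natCast]
    ring
  exact (mul_eq_zero.1 (key k)).resolve_left (sub_ne_zero.2 (by exact_mod_cast hk))

theorem circleCoeff_eq_zero_of_lminus {u : ℝ → ℝ} (hu : AngularIntegrable u) {m : ℕ}
    (h : ∀ φ, lminus m u φ = 0) {k : ℕ} (hk : m < k) :
    circleCoeff (fun x => (u x : ℂ)) k = 0 := by
  have hU : AngularIntegrable fun x => (u x : ℂ) := hu.clm_comp Complex.ofRealCLM
  have hR : Integrable (rop m fun x => (u x : ℂ)) := by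
    obtain ⟨C, hC⟩ := hU.norm_rop_le m
    exact Integrable.mono' (integrable_weight.const_mul C) (hU.aestronglyMeasurable_rop m)
      (Eventually.of_forall hC)
  have key : ∀ k : ℕ, ((k : ℂ) - m + (m - k : ℕ)) * circleCoeff (fun x => (u x : ℂ)) k = 0 := by
    refine eq_zero_of_mul_recursion (m := m) (by simp) fun k => ?_
    obtain ⟨ψ, h1, h2⟩ := exists_test_functions hU k
    have h3 := (h1.sub (h2 _ (hU.weight_mul.const_mul (m : ℂ)))).add (h2 _ hR)
    have h4 : ∀ n, (∫ x, absNablaC (ψ n) x * u x) - (∫ x, ψ n x * (m * (weight x * u x)))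
        + ∫ x, ψ n x * rop m (fun x => (u x : ℂ)) x = 0 := by
      intro n
      rw [← ofReal_lminus_rePart_add hu, h, h]
      simp
    have h5 := tendsto_nhds_unique h3 (by simp_rw [h4]; exact tendsto_const_nhds)
    rw [← h5, integral_stereo_pow_mul_rop hU, integral_stereo_pow_mul_rop hU]
    simp_rw [mul_left_comm _ (m : ℂ), integral_const_mul]
    simp only [circleCoeff, zpow_natCast]
    ring
  -- Beyond m the operator R contributes nothing, and the symbol k - m is nonzero.
  have := key k
  rw [Nat.sub_eq_zero_of_le hk.le, Nat.cast_zero, add_zero] at this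
  exact (mul_eq_zero.1 this).resolve_left (sub_ne_zero.2 (by exact_mod_cast hk.ne'))

end HalfHarmonic
end

noncomputable section
namespace HalfHarmonic
open Complex Filter Topology

/-! ### Uniqueness of Fourier coefficients -/

/-- Integrable functions all of whose Fourier coefficients vanish. -/
def HasZeroCoeffs (G : ℝ → ℂ) : Prop := Integrable G ∧ ∀ p : ℤ, ∫ x, stereo x ^ p * G x = 0

theorem HasZeroCoeffs.conj {G : ℝ → ℂ} (h : HasZeroCoeffs G) :
    HasZeroCoeffs fun x => (starRingEnd ℂ) (G x) := by
  refine ⟨Complex.conjCLE.toContinuousLinearMap.integrable_comp h.1, fun p => ?_⟩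
  have := congrArg (starRingEnd ℂ) (h.2 (-p))
  rw [← integral_conj, map_zero] at this
  rw [← this]
  congr 1
  ext x
  rw [map_mul, conj_stereo_zpow, neg_neg]

/-- The bounded continuous multipliers that preserve the vanishing of all Fourier coefficients. -/
def zeroCoeffMultipliers : StarSubalgebra ℂ (BoundedContinuousFunction ℝ ℂ) where
  carrier := {g | ∀ G, HasZeroCoeffs G → HasZeroCoeffs fun x => g x * G x}
  mul_mem' {a b} ha hb G hG := by
    have := ha _ (hb G hG)
    simpa only [BoundedContinuousFunction.coe_mul, Pi.mul_apply, mul_assoc] using this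
  add_mem' {a b} ha hb G hG := by
    have h1 := ha G hG
    have h2 := hb G hG
    simp only [BoundedContinuousFunction.coe_add, Pi.add_apply, add_mul]
    refine ⟨h1.1.add h2.1, fun p => ?_⟩
    simp only [mul_add]
    rw [integral_add (integrable_stereo_zpow_mul h1.1 p) (integrable_stereo_zpow_mul h2.1 p),
      h1.2, h2.2, add_zero]
  algebraMap_mem' r G hG := by
    refine ⟨hG.1.const_mul r, fun p => ?_⟩
    have : ∀ x, stereo x ^ p * ((algebraMap ℂ (BoundedContinuousFunction ℝ ℂ) r) x * G x)
        = r * (stereo x ^ p * G x) := fun x => by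
      rw [BoundedContinuousFunction.algebraMap_apply, smul_eq_mul]
      ring
    simp_rw [this]
    rw [integral_const_mul, hG.2, mul_zero]
  star_mem' {a} ha G hG := by
    have := (ha _ hG.conj).conj
    simpa only [map_mul, Complex.conj_conj, BoundedContinuousFunction.coe_star, Pi.star_apply,
      RCLike.star_def] using this

/-- `stereo` as a bounded continuous function. -/
def stereoBounded : BoundedContinuousFunction ℝ ℂ :=
  BoundedContinuousFunction.ofNormedAddCommGroup stereo continuous_stereo 1
    fun x => (norm_stereo x).le

theorem stereoBounded_mem : stereoBounded ∈ zeroCoeffMultipliers := by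
  intro G hG
  have h := fun p => integrable_stereo_zpow_mul hG.1 p
  have h1 : Integrable fun x => stereo x * G x := by simpa only [zpow_one] using h 1
  refine ⟨h1, fun p => ?_⟩
  rw [← hG.2 (p + 1)]
  congr 1
  ext x
  rw [zpow_add₀ (stereo_ne_zero x), zpow_one, mul_assoc]
  rfl

/-- The positive and negative parts of `v` are densities of finite measures that integrate every
element of `zeroCoeffMultipliers` equally. This star subalgebra contains the injective function
`stereo`, so it separates points and the two measures coincide. -/
theorem ae_eq_zero_of_hasZeroCoeffs {v : ℝ → ℝ} (h : HasZeroCoeffs fun x => (v x : ℂ)) :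
    v =ᵐ[volume] 0 := by
  have hv : Integrable v := by simpa using h.1.re
  have hm1 : AEMeasurable (fun x => ENNReal.ofReal (v x)) volume :=
    hv.aestronglyMeasurable.aemeasurable.ennreal_ofReal
  have hm2 : AEMeasurable (fun x => ENNReal.ofReal (-v x)) volume :=
    hv.aestronglyMeasurable.aemeasurable.neg.ennreal_ofReal
  have hf1 : IsFiniteMeasure (volume.withDensity fun x => ENNReal.ofReal (v x)) :=
    isFiniteMeasure_withDensity_ofReal hv.hasFiniteIntegral
  have hf2 : IsFiniteMeasure (volume.withDensity fun x => ENNReal.ofReal (-v x)) :=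
    isFiniteMeasure_withDensity_ofReal hv.neg.hasFiniteIntegral
  have heq : (volume.withDensity fun x => ENNReal.ofReal (v x))
      = volume.withDensity fun x => ENNReal.ofReal (-v x) := by
    refine ext_of_forall_mem_subalgebra_integral_eq_of_polish (𝕜 := ℂ)
      (A := zeroCoeffMultipliers) ?_ fun g hg => ?_
    · intro x y hxy
      refine ⟨stereo, ⟨stereoBounded.toContinuousMap, ⟨stereoBounded, stereoBounded_mem, rfl⟩, rfl⟩,
        fun hs => hxy (stereo_injective hs)⟩
    · rw [integral_withDensity_eq_integral_toReal_smul₀ hm1 (by simp),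
        integral_withDensity_eq_integral_toReal_smul₀ hm2 (by simp), ← sub_eq_zero,
        ← integral_sub]
      · have h0 := (hg _ h).2 0
        simp only [zpow_zero, one_mul] at h0
        rw [← h0]
        congr 1
        ext x
        rw [ENNReal.toReal_ofReal', ENNReal.toReal_ofReal', ← sub_smul, real_smul, mul_comm (g x)]
        congr 2
        rcases le_total 0 (v x) with hx | hx
        · rw [max_eq_left hx, max_eq_right (by linarith), sub_zero]
        · rw [max_eq_right hx, max_eq_left (by linarith), zero_sub, neg_neg]
      · have : Integrable fun x => (ENNReal.ofReal (v x)).toReal := by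
          simp only [ENNReal.toReal_ofReal']
          exact hv.pos_part
        exact this.smul_bdd ‖g‖ g.continuous.aestronglyMeasurable
          (Eventually.of_forall g.norm_coe_le_norm)
      · have : Integrable fun x => (ENNReal.ofReal (-v x)).toReal := by
          simp only [ENNReal.toReal_ofReal']
          exact hv.neg.pos_part
        exact this.smul_bdd ‖g‖ g.continuous.aestronglyMeasurable
          (Eventually.of_forall g.norm_coe_le_norm)
  have hfin : ∫⁻ x, ENNReal.ofReal (v x) ≠ ⊤ := by
    have := hf1.measure_univ_lt_top
    rw [withDensity_apply _ MeasurableSet.univ, setLIntegral_univ] at this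
    exact this.ne
  filter_upwards [(withDensity_eq_iff hm1 hm2 hfin).1 heq] with x hx
  rcases le_total 0 (v x) with h0 | h0
  · rw [ENNReal.ofReal_of_nonpos (by linarith : -v x ≤ 0), ENNReal.ofReal_eq_zero] at hx
    exact le_antisymm hx h0
  · rw [ENNReal.ofReal_of_nonpos h0, eq_comm, ENNReal.ofReal_eq_zero] at hx
    exact le_antisymm h0 (neg_nonpos.1 hx)

/-- Nonnegative indices suffice: for real `u` the coefficients of negative index are complex
conjugates. -/
theorem ae_eq_zero_of_circleCoeff {u : ℝ → ℝ} (hu : AngularIntegrable u)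
    (h : ∀ k : ℕ, circleCoeff (fun x => (u x : ℂ)) k = 0) : u =ᵐ[volume] 0 := by
  have hU : AngularIntegrable fun x => (u x : ℂ) := hu.clm_comp Complex.ofRealCLM
  have hz : HasZeroCoeffs fun x => ((weight x * u x : ℝ) : ℂ) := by
    refine ⟨by simpa using hU.weight_mul, fun p => ?_⟩
    push_cast
    obtain ⟨n, rfl | rfl⟩ := p.eq_nat_or_neg
    · exact h n
    · have := congrArg (starRingEnd ℂ) (h n)
      rw [circleCoeff, ← integral_conj, map_zero] at this
      rw [← this]
      congr 1
      ext x
      rw [map_mul, conj_stereo_zpow, map_mul, Complex.conj_ofReal, Complex.conj_ofReal]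
  filter_upwards [ae_eq_zero_of_hasZeroCoeffs hz] with x hx
  exact (mul_eq_zero.1 hx).resolve_left (weight_pos x).ne'

/-! ### Trigonometric sums -/

variable {𝕜 : Type*} [RCLike 𝕜]

/-- The trigonometric sum `∑ (α_k cos kθ + β_k sin kθ)`. -/
def trigSum (S : Finset ℕ) (α β : ℕ → 𝕜) (x : ℝ) : 𝕜 :=
  ∑ k ∈ S, (α k * (((stereo x ^ k).re : ℝ) : 𝕜) + β k * (((stereo x ^ k).im : ℝ) : 𝕜))

theorem continuous_trigSum (S : Finset ℕ) (α β : ℕ → 𝕜) : Continuous (trigSum S α β) := by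
  refine continuous_finsetSum _ fun k _ => (continuous_const.mul ?_).add (continuous_const.mul ?_)
  · exact RCLike.continuous_ofReal.comp (Complex.continuous_re.comp (continuous_stereo.pow k))
  · exact RCLike.continuous_ofReal.comp (Complex.continuous_im.comp (continuous_stereo.pow k))

theorem coeFn_fFun (k : ℕ) : fFun 𝕜 k =ᵐ[volume] fun x => (((stereo x ^ k).im : ℝ) : 𝕜) :=
  AEEqFun.coeFn_mk _ _

theorem coeFn_gFun (k : ℕ) : gFun 𝕜 k =ᵐ[volume] fun x => (((stereo x ^ k).re : ℝ) : 𝕜) :=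
  AEEqFun.coeFn_mk _ _

theorem coeFn_sum_eq_trigSum (S : Finset ℕ) (α β : ℕ → 𝕜) :
    (∑ k ∈ S, (α k • gFun 𝕜 k + β k • fFun 𝕜 k) : ℝ →ₘ[volume] 𝕜)
      =ᵐ[volume] trigSum S α β := by
  induction S using Finset.induction_on with
  | empty =>
    rw [Finset.sum_empty]
    exact AEEqFun.coeFn_zero
  | insert k S hk ih =>
    rw [Finset.sum_insert hk]
    filter_upwards [ih, AEEqFun.coeFn_add (α k • gFun 𝕜 k + β k • fFun 𝕜 k)
      (∑ k ∈ S, (α k • gFun 𝕜 k + β k • fFun 𝕜 k)), AEEqFun.coeFn_add (α k • gFun 𝕜 k)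
      (β k • fFun 𝕜 k), AEEqFun.coeFn_smul (α k) (gFun 𝕜 k), AEEqFun.coeFn_smul (β k) (fFun 𝕜 k),
      coeFn_fFun (𝕜 := 𝕜) k, coeFn_gFun (𝕜 := 𝕜) k] with x h1 h2 h3 h4 h5 h6 h7
    rw [h2, Pi.add_apply, h1, h3, Pi.add_apply, h4, h5, Pi.smul_apply, Pi.smul_apply, h6, h7,
      trigSum, trigSum, Finset.sum_insert hk]
    rfl

theorem norm_trigSum_le (S : Finset ℕ) (α β : ℕ → 𝕜) (x : ℝ) :
    ‖trigSum S α β x‖ ≤ ∑ k ∈ S, (‖α k‖ + ‖β k‖) := by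
  refine (norm_sum_le _ _).trans (Finset.sum_le_sum fun k _ => (norm_add_le _ _).trans ?_)
  have h1 : ‖stereo x ^ k‖ = 1 := by simp [norm_stereo]
  have hre := Complex.abs_re_le_norm (stereo x ^ k)
  have him := Complex.abs_im_le_norm (stereo x ^ k)
  rw [h1] at hre him
  rw [norm_mul, norm_mul, RCLike.norm_ofReal, RCLike.norm_ofReal]
  exact add_le_add (mul_le_of_le_one_right (norm_nonneg _) hre)
    (mul_le_of_le_one_right (norm_nonneg _) him)

theorem angularIntegrable_trigSum (S : Finset ℕ) (α β : ℕ → 𝕜) :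
    AngularIntegrable (trigSum S α β) :=
  .of_bounded (continuous_trigSum S α β).aestronglyMeasurable (norm_trigSum_le S α β)

/-- Each summand is (a - ib)/2 z^k + (a + ib)/2 z^(-k), and integration against z^j keeps the second
half for k = j. For j = 0 both halves survive and the sine part cancels. -/
theorem circleCoeff_trigSum (S : Finset ℕ) (a b : ℕ → ℝ) (j : ℕ) :
    circleCoeff (fun x => ((trigSum S a b x : ℝ) : ℂ)) j
      = if j ∈ S then (if j = 0 then 2 * π * (a 0 : ℂ) else π * (a j + b j * I)) else 0 := by
  have h1 : ∀ x, stereo x ^ (j : ℤ) * (weight x * ((trigSum S a b x : ℝ) : ℂ))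
      = ∑ k ∈ S, (((a k : ℂ) - b k * I) / 2 * (stereo x ^ ((j : ℤ) + k) * weight x)
        + ((a k : ℂ) + b k * I) / 2 * (stereo x ^ ((j : ℤ) - k) * weight x)) := by
    intro x
    rw [trigSum]
    push_cast
    rw [Finset.mul_sum, Finset.mul_sum]
    refine Finset.sum_congr rfl fun k _ => ?_
    rw [zpow_add₀ (stereo_ne_zero x), zpow_sub₀ (stereo_ne_zero x), div_eq_mul_inv (_ ^ (j : ℤ)),
      ← _root_.zpow_neg, ← conj_stereo_zpow, zpow_natCast, zpow_natCast]
    have hz := Complex.re_add_im (stereo x ^ k)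
    have hz' : (starRingEnd ℂ) (stereo x ^ k)
        = (stereo x ^ k).re - (stereo x ^ k).im * I := by
      apply Complex.ext <;> simp [-map_pow]
    rw [hz']
    conv_rhs => rw [← hz]
    simp only [RCLike.ofReal_real_eq_id, id, add_re, add_im, ofReal_re, ofReal_im, mul_re, mul_im,
      I_re, I_im, mul_zero, mul_one, sub_zero, add_zero, zero_add]
    linear_combination ((stereo x ^ j * weight x * b k * (stereo x ^ k).im) : ℂ) * I_mul_I
  have hi : ∀ p : ℤ, Integrable fun x => stereo x ^ p * (weight x : ℂ) := fun p =>
    integrable_stereo_zpow_mul integrable_weight.ofReal p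
  unfold circleCoeff
  simp_rw [h1]
  have hi2 : ∀ k : ℕ, Integrable fun x =>
      ((a k : ℂ) - b k * I) / 2 * (stereo x ^ ((j : ℤ) + k) * weight x)
        + ((a k : ℂ) + b k * I) / 2 * (stereo x ^ ((j : ℤ) - k) * weight x) := fun k =>
    ((hi _).const_mul _).add ((hi _).const_mul _)
  rw [integral_finsetSum _ fun k _ => hi2 k]
  simp_rw [integral_add ((hi _).const_mul _) ((hi _).const_mul _), integral_const_mul,
    integral_stereo_zpow_mul_weight]
  rw [← Finset.sum_ite_eq' S j fun j => if j = 0 then 2 * π * (a 0 : ℂ) else π * (a j + b j * I)]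
  refine Finset.sum_congr rfl fun k _ => ?_
  rcases eq_or_ne k j with rfl | hkj
  · rcases eq_or_ne k 0 with rfl | hk
    · simp
      ring
    · rw [if_neg (by omega), if_pos (by omega), if_pos rfl, if_neg hk]
      ring
  · rw [if_neg (by omega), if_neg (by omega), if_neg hkj]
    ring

theorem exists_trigSum_ae_eq {u : ℝ → ℝ} (hu : AngularIntegrable u) {S : Finset ℕ}
    (h : ∀ k ∉ S, circleCoeff (fun x => (u x : ℂ)) k = 0) :
    ∃ a b : ℕ → ℝ, u =ᵐ[volume] trigSum S a b := by
  set c : ℕ → ℂ := fun k => circleCoeff (fun x => (u x : ℂ)) k with hc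
  -- The inverse of `circleCoeff_trigSum`; the value `b 0` plays no role since sin 0 = 0.
  set a : ℕ → ℝ := fun k => if k = 0 then (c 0).re / (2 * π) else (c k).re / π with ha
  set b : ℕ → ℝ := fun k => (c k).im / π with hb
  refine ⟨a, b, ?_⟩
  have ht : AngularIntegrable fun x => -trigSum S a b x := by
    refine (angularIntegrable_trigSum S a b).neg.congr (Eventually.of_forall fun x => ?_)
    simp
  have hv := hu.add ht
  have hU : AngularIntegrable fun x => (u x : ℂ) := hu.clm_comp Complex.ofRealCLM
  have hT : AngularIntegrable fun x => ((trigSum S a b x : ℝ) : ℂ) :=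
    (angularIntegrable_trigSum S a b).clm_comp Complex.ofRealCLM
  have hc0 : ((c 0).re : ℂ) = c 0 := by
    have : (starRingEnd ℂ) (c 0) = c 0 := by
      simp only [hc, circleCoeff]
      rw [← integral_conj]
      simp
    exact Complex.conj_eq_iff_re.1 this
  have hπ : (π : ℂ) ≠ 0 := by exact_mod_cast Real.pi_ne_zero
  have hz : ∀ j : ℕ, circleCoeff (fun x => ((u x + -trigSum S a b x : ℝ) : ℂ)) j = 0 := by
    intro j
    have : circleCoeff (fun x => ((u x + -trigSum S a b x : ℝ) : ℂ)) j
        = c j - circleCoeff (fun x => ((trigSum S a b x : ℝ) : ℂ)) j := by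
      simp only [hc, circleCoeff]
      rw [← integral_sub (hU.stereo_zpow _) (hT.stereo_zpow _)]
      congr 1
      ext x
      push_cast
      ring
    rw [this, circleCoeff_trigSum]
    split_ifs with hj hj0
    · subst hj0
      simp only [ha, if_pos]
      push_cast
      rw [hc0]
      field_simp
      ring
    · simp only [ha, hb, if_neg hj0]
      push_cast
      field_simp
      linear_combination -Complex.re_add_im (c j)
    · rw [sub_zero]
      exact h j hj
  filter_upwards [ae_eq_zero_of_circleCoeff hv hz] with x hx
  have : u x + -trigSum S a b x = 0 := hx
  linarith

/-- A class whose real and imaginary parts have Fourier coefficients supported in `S` is a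
trigonometric sum over `S`. -/
theorem exists_eq_sum_of_circleCoeff {f : ℝ →ₘ[volume] 𝕜} (hf : AngularIntegrable f)
    {S : Finset ℕ}
    (h : ∀ T : 𝕜 →L[ℝ] ℝ, ∀ k ∉ S, circleCoeff (fun x => ((T (f x) : ℝ) : ℂ)) k = 0) :
    ∃ α β : ℕ → 𝕜, f = ∑ k ∈ S, (α k • gFun 𝕜 k + β k • fFun 𝕜 k) := by
  obtain ⟨a, b, h1⟩ := exists_trigSum_ae_eq (hf.clm_comp RCLike.reCLM) (h RCLike.reCLM)
  obtain ⟨a', b', h2⟩ := exists_trigSum_ae_eq (hf.clm_comp RCLike.imCLM) (h RCLike.imCLM)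
  refine ⟨fun k => (a k : 𝕜) + a' k * RCLike.I, fun k => (b k : 𝕜) + b' k * RCLike.I,
    AEEqFun.ext ?_⟩
  filter_upwards [h1, h2, coeFn_sum_eq_trigSum S (fun k => (a k : 𝕜) + a' k * RCLike.I)
    fun k => (b k : 𝕜) + b' k * RCLike.I] with x h1 h2 h3
  rw [h3, ← RCLike.re_add_im (f x)]
  have e1 : RCLike.re (f x) = trigSum S a b x := h1
  have e2 : RCLike.im (f x) = trigSum S a' b' x := h2
  rw [e1, e2]
  simp only [trigSum]
  push_cast
  rw [Finset.sum_mul, ← Finset.sum_add_distrib]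
  refine Finset.sum_congr rfl fun k _ => ?_
  simp only [RCLike.ofReal_real_eq_id, id]
  ring

theorem eq_zero_of_sum_eq_zero {S : Finset ℕ} {α β : ℕ → 𝕜}
    (h : ∑ k ∈ S, (α k • gFun 𝕜 k + β k • fFun 𝕜 k) = 0) {k : ℕ} (hk : k ∈ S) :
    α k = 0 ∧ (k ≠ 0 → β k = 0) := by
  have h0 : trigSum S α β =ᵐ[volume] 0 := by
    refine (coeFn_sum_eq_trigSum S α β).symm.trans ?_
    rw [h]
    exact AEEqFun.coeFn_zero
  have key : ∀ T : 𝕜 →L[ℝ] ℝ, T (α k) = 0 ∧ (k ≠ 0 → T (β k) = 0) := by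
    intro T
    have hT : ∀ x, T (trigSum S α β x) = trigSum S (fun k => T (α k)) (fun k => T (β k)) x := by
      intro x
      simp only [trigSum, map_sum, map_add]
      refine Finset.sum_congr rfl fun k _ => ?_
      simp only [RCLike.ofReal_real_eq_id, id]
      have (c : 𝕜) (r : ℝ) : T (c * (r : 𝕜)) = T c * r := by
        rw [mul_comm, ← RCLike.real_smul_eq_coe_mul, map_smul, smul_eq_mul, mul_comm]
      rw [this, this]
    have hc := circleCoeff_trigSum S (fun k => T (α k)) (fun k => T (β k)) k
    have hc0 : circleCoeff (fun x => ((trigSum S (fun k => T (α k)) (fun k => T (β k)) x : ℝ) : ℂ)) k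
        = 0 := by
      unfold circleCoeff
      rw [integral_eq_zero_of_ae]
      filter_upwards [h0] with x hx
      rw [← hT, hx]
      simp
    rw [hc0, if_pos hk] at hc
    have hπ : (π : ℂ) ≠ 0 := by exact_mod_cast Real.pi_ne_zero
    split_ifs at hc with hk0
    · subst hk0
      refine ⟨?_, fun h => absurd rfl h⟩
      have := (mul_eq_zero.1 hc.symm).resolve_left (mul_ne_zero two_ne_zero hπ)
      exact_mod_cast this
    · have := (mul_eq_zero.1 hc.symm).resolve_left hπ
      have hre := congrArg Complex.re this
      have him := congrArg Complex.im this
      simp at hre him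
      exact ⟨hre, fun _ => him⟩
  have hre := key RCLike.reCLM
  have him := key RCLike.imCLM
  refine ⟨RCLike.ext (by simpa using hre.1) (by simpa using him.1), fun hk0 =>
    RCLike.ext (by simpa using hre.2 hk0) (by simpa using him.2 hk0)⟩

end HalfHarmonic
end

noncomputable section
namespace HalfHarmonic
open Complex Filter Topology

variable {𝕜 : Type*} [RCLike 𝕜]

/-! ### The nullspaces -/

/-! ### The energy space: weighted integrability and Lipschitz functions on the circle. -/

theorem sub_sq_le_mul (x y : ℝ) : (x - y) ^ 2 ≤ (1 + x ^ 2) * (1 + y ^ 2) := by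
  nlinarith [sq_nonneg (1 + x * y)]

/-- Some x has a finite inner energy integral. For this x, |f(y)| ≤ |f(x)| + 1 + |f(x) - f(y)|², and
`weight y` is at most a constant times |x - y|⁻². -/
theorem MemHdot.angularIntegrable {f : ℝ →ₘ[volume] 𝕜} (h : MemHdot f) : AngularIntegrable f := by
  obtain ⟨x, hx⟩ : ∃ x : ℝ, ∫⁻ y : ℝ, ENNReal.ofReal (‖f x - f y‖ ^ 2 / |x - y| ^ 2) < ⊤ := by
    by_contra! hcon
    have : ∀ x : ℝ, ∫⁻ y : ℝ, ENNReal.ofReal (‖f x - f y‖ ^ 2 / |x - y| ^ 2) = ⊤ :=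
      fun x => top_le_iff.1 (hcon x)
    rw [MemHdot, lintegral_congr this] at h
    simp at h
  have hfm := f.aestronglyMeasurable
  have hq : Integrable fun y : ℝ => ‖f x - f y‖ ^ 2 / |x - y| ^ 2 := by
    refine ⟨?_, ?_⟩
    · exact (((aestronglyMeasurable_const.sub hfm).norm.aemeasurable.pow_const 2).div
        (by fun_prop)).aestronglyMeasurable
    · rw [hasFiniteIntegral_iff_ofReal (Eventually.of_forall fun y => by positivity)]
      exact hx
  refine Integrable.mono' (g := fun y => weight y * (‖f x‖ + 1)
    + 2 * (1 + x ^ 2) * (‖f x - f y‖ ^ 2 / |x - y| ^ 2))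
    ((integrable_weight.mul_const _).add (hq.const_mul _))
    (continuous_weight.aestronglyMeasurable.smul hfm) ?_
  have hne : ∀ᵐ y : ℝ, y ≠ x := by simp [ae_iff, measure_singleton]
  filter_upwards [hne] with y hy
  rw [norm_smul, Real.norm_of_nonneg (weight_pos y).le]
  set d := ‖f x - f y‖
  have h1 : ‖f y‖ ≤ ‖f x‖ + d := by
    have := norm_sub_norm_le (f y) (f x)
    rw [norm_sub_rev] at this
    linarith
  have h2 : d ≤ 1 + d ^ 2 := by nlinarith [sq_nonneg (d - 1), sq_nonneg d]
  have h3 : weight y * d ^ 2 ≤ 2 * (1 + x ^ 2) * (d ^ 2 / |x - y| ^ 2) := by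
    have hpos : 0 < (x - y) ^ 2 := by
      have := sub_ne_zero.2 hy.symm
      positivity
    rw [sq_abs, weight, ← mul_div_assoc, div_mul_eq_mul_div,
      div_le_div_iff₀ (by positivity) hpos]
    have := mul_le_mul_of_nonneg_left (sub_sq_le_mul x y) (by positivity : 0 ≤ 2 * d ^ 2)
    linarith
  have h4 : weight y * ‖f y‖ ≤ weight y * (‖f x‖ + (1 + d ^ 2)) :=
    mul_le_mul_of_nonneg_left (by linarith) (weight_pos y).le
  linarith

/-- Functions that are Lipschitz on the circle. -/
def StereoLipschitz (F : ℝ → 𝕜) : Prop := ∃ C, ∀ x y, ‖F x - F y‖ ≤ C * ‖stereo x - stereo y‖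

theorem StereoLipschitz.continuous {F : ℝ → 𝕜} (h : StereoLipschitz F) : Continuous F := by
  obtain ⟨C, hC⟩ := h
  refine continuous_iff_continuousAt.2 fun x => ?_
  refine tendsto_iff_norm_sub_tendsto_zero.2 (squeeze_zero (fun y => norm_nonneg _)
    (fun y => hC y x) ?_)
  have := (((continuous_stereo.tendsto x).sub_const (stereo x)).norm).const_mul C
  simpa using this

theorem StereoLipschitz.angularIntegrable {F : ℝ → 𝕜} (h : StereoLipschitz F) :
    AngularIntegrable F := by
  have hcont := h.continuous
  obtain ⟨C, hC⟩ := h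
  refine .of_bounded (C := ‖F 0‖ + |C| * 2) hcont.aestronglyMeasurable fun x => ?_
  have h1 := norm_sub_norm_le (F x) (F 0)
  have h2 := hC x 0
  have h3 : C * ‖stereo x - stereo 0‖ ≤ |C| * 2 := by
    refine mul_le_mul (le_abs_self C) ((norm_sub_le _ _).trans ?_) (norm_nonneg _) (abs_nonneg C)
    rw [norm_stereo, norm_stereo]
    norm_num
  linarith

theorem StereoLipschitz.add {F G : ℝ → 𝕜} (hF : StereoLipschitz F) (hG : StereoLipschitz G) :
    StereoLipschitz fun x => F x + G x := by
  obtain ⟨C, hC⟩ := hF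
  obtain ⟨D, hD⟩ := hG
  refine ⟨C + D, fun x y => ?_⟩
  rw [add_sub_add_comm, add_mul]
  exact (norm_add_le _ _).trans (add_le_add (hC x y) (hD x y))

theorem StereoLipschitz.const_mul {F : ℝ → 𝕜} (hF : StereoLipschitz F) (c : 𝕜) :
    StereoLipschitz fun x => c * F x := by
  obtain ⟨C, hC⟩ := hF
  refine ⟨‖c‖ * C, fun x y => ?_⟩
  rw [← mul_sub, norm_mul, mul_assoc]
  exact mul_le_mul_of_nonneg_left (hC x y) (norm_nonneg _)

/-- By `norm_stereo_sub_sq` the energy density is at most C² `weight x * weight y`, whose double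
integral is finite. -/
theorem StereoLipschitz.memHdot {F : ℝ → 𝕜} (hF : StereoLipschitz F) {f : ℝ →ₘ[volume] 𝕜}
    (h : f =ᵐ[volume] F) : MemHdot f := by
  obtain ⟨C, hC⟩ := hF
  have hw : ∫⁻ x, ENNReal.ofReal (weight x) < ⊤ := integrable_weight.lintegral_lt_top
  have hb : ∀ x y, ‖F x - F y‖ ^ 2 / |x - y| ^ 2 ≤ C ^ 2 * weight x * weight y := by
    intro x y
    have hwx := weight_pos x
    have hwy := weight_pos y
    refine div_le_of_le_mul₀ (by positivity) (by positivity) ?_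
    have := pow_le_pow_left₀ (norm_nonneg _) (hC x y) 2
    rw [mul_pow, norm_stereo_sub_sq] at this
    rw [sq_abs]
    linarith
  have : ∀ᵐ x : ℝ, ∫⁻ y : ℝ, ENNReal.ofReal (‖f x - f y‖ ^ 2 / |x - y| ^ 2)
      ≤ ENNReal.ofReal (C ^ 2) * ENNReal.ofReal (weight x)
        * ∫⁻ y, ENNReal.ofReal (weight y) := by
    filter_upwards [h] with x hx
    rw [← lintegral_const_mul' _ _ (by finiteness)]
    refine lintegral_mono_ae ?_
    filter_upwards [h] with y hy
    rw [hx, hy, ← ENNReal.ofReal_mul (sq_nonneg C), ← ENNReal.ofReal_mul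
      (mul_nonneg (sq_nonneg C) (weight_pos x).le)]
    exact ENNReal.ofReal_le_ofReal (hb x y)
  refine (lintegral_mono_ae this).trans_lt ?_
  rw [lintegral_mul_const' _ _ hw.ne, lintegral_const_mul' _ _ (by finiteness)]
  exact ENNReal.mul_lt_top (ENNReal.mul_lt_top (by finiteness) hw) hw

theorem norm_stereo_pow_sub_le (k : ℕ) (x y : ℝ) :
    ‖stereo x ^ k - stereo y ^ k‖ ≤ k * ‖stereo x - stereo y‖ := by
  rw [← (Commute.all (stereo x) (stereo y)).geom_sum₂_mul, norm_mul]
  refine mul_le_mul_of_nonneg_right ((norm_sum_le _ _).trans (le_of_eq ?_)) (norm_nonneg _)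
  simp [norm_stereo]

/-- The real-linear map `w ↦ Im w` with values in `𝕜`. -/
def imMap (𝕜 : Type*) [RCLike 𝕜] : ℂ →L[ℝ] 𝕜 := RCLike.ofRealCLM.comp Complex.imCLM

/-- The real-linear map `w ↦ Re w` with values in `𝕜`. -/
def reMap (𝕜 : Type*) [RCLike 𝕜] : ℂ →L[ℝ] 𝕜 := RCLike.ofRealCLM.comp Complex.reCLM

theorem stereoLipschitz_clm (T : ℂ →L[ℝ] 𝕜) (k : ℕ) :
    StereoLipschitz fun x => T (stereo x ^ k) := by
  refine ⟨‖T‖ * k, fun x y => ?_⟩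
  rw [← map_sub, mul_assoc]
  exact (T.le_opNorm _).trans (mul_le_mul_of_nonneg_left (norm_stereo_pow_sub_le k x y)
    (norm_nonneg _))

/-- If `L` annihilates generators that are Lipschitz on the circle, it annihilates their span, which
consists of classes in `Ḣ^{1/2}`. -/
theorem span_subset_of_generators {L : (ℝ → 𝕜) → SchwartzMap ℝ ℝ → 𝕜}
    (hadd : ∀ {F G : ℝ → 𝕜}, AngularIntegrable F → AngularIntegrable G → ∀ φ,
      L (fun x => F x + G x) φ = L F φ + L G φ)
    (hmap : ∀ {F : ℝ → 𝕜}, AngularIntegrable F → ∀ (T : 𝕜 →L[ℝ] 𝕜) φ,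
      T (L F φ) = L (fun x => T (F x)) φ)
    (hcongr : ∀ {F G : ℝ → 𝕜}, F =ᵐ[volume] G → ∀ φ, L F φ = L G φ)
    {s : Set (ℝ →ₘ[volume] 𝕜)}
    (hs : ∀ f ∈ s, ∃ F : ℝ → 𝕜, StereoLipschitz F ∧ f =ᵐ[volume] F ∧ ∀ φ, L F φ = 0)
    {f : ℝ →ₘ[volume] 𝕜} (hf : f ∈ Submodule.span 𝕜 s) : MemHdot f ∧ ∀ φ, L f φ = 0 := by
  have key : ∃ F : ℝ → 𝕜, StereoLipschitz F ∧ f =ᵐ[volume] F ∧ ∀ φ, L F φ = 0 := by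
    have hsmul : ∀ (c : 𝕜) (F : ℝ → 𝕜), StereoLipschitz F → (∀ φ, L F φ = 0) →
        ∀ φ, L (fun x => c * F x) φ = 0 := by
      intro c F hF h φ
      have := hmap hF.angularIntegrable
        ((ContinuousLinearMap.mul 𝕜 𝕜 c).restrictScalars ℝ) φ
      rw [h] at this
      simpa using this.symm
    induction hf using Submodule.span_induction with
    | mem f hf => exact hs f hf
    | zero =>
      refine ⟨fun _ => 0, ⟨0, by simp⟩, AEEqFun.coeFn_zero, fun φ => ?_⟩
      -- That `L` kills the zero function follows from compatibility with the zero map.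
      have h0 : AngularIntegrable fun _ : ℝ => (0 : 𝕜) := by simp [AngularIntegrable]
      simpa using (hmap h0 (0 : 𝕜 →L[ℝ] 𝕜) φ).symm
    | add f g _ _ hf hg =>
      obtain ⟨F, hF1, hF2, hF3⟩ := hf
      obtain ⟨G, hG1, hG2, hG3⟩ := hg
      refine ⟨fun x => F x + G x, hF1.add hG1, ?_, fun φ => ?_⟩
      · filter_upwards [AEEqFun.coeFn_add f g, hF2, hG2] with x h1 h2 h3
        rw [h1, Pi.add_apply, h2, h3]
      · rw [hadd hF1.angularIntegrable hG1.angularIntegrable, hF3, hG3, add_zero]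
    | smul c f _ hf =>
      obtain ⟨F, hF1, hF2, hF3⟩ := hf
      refine ⟨fun x => c * F x, hF1.const_mul c, ?_, hsmul c F hF1 hF3⟩
      filter_upwards [AEEqFun.coeFn_smul c f, hF2] with x h1 h2
      rw [h1, Pi.smul_apply, h2, smul_eq_mul]
  obtain ⟨F, hF1, hF2, hF3⟩ := key
  exact ⟨hF1.memHdot hF2, fun φ => (hcongr hF2 φ).trans (hF3 φ)⟩

/-! ### Identification of both nullspaces with spans of trigonometric functions. -/

theorem gFun_zero : gFun 𝕜 0 = AEEqFun.const ℝ (1 : 𝕜) := by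
  refine AEEqFun.ext ?_
  filter_upwards [coeFn_gFun (𝕜 := 𝕜) 0, AEEqFun.coeFn_const ℝ (1 : 𝕜)] with x h1 h2
  rw [h1, h2]
  simp

theorem fFun_zero : fFun 𝕜 0 = 0 := by
  refine AEEqFun.ext ?_
  filter_upwards [coeFn_fFun (𝕜 := 𝕜) 0, AEEqFun.coeFn_zero (β := 𝕜) (μ := volume)] with x h1 h2
  rw [h1, h2]
  simp

theorem smul_fFun_zero (c : 𝕜) : c • fFun 𝕜 0 = 0 := by
  rw [fFun_zero]
  exact smul_zero (A := ℝ →ₘ[volume] 𝕜) c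

theorem exists_eq_sum_of_mem_nullLplus {m : ℕ} {f : ℝ →ₘ[volume] 𝕜} (h : f ∈ nullLplus 𝕜 m) :
    ∃ α β : ℕ → 𝕜, f = ∑ k ∈ {m}, (α k • gFun 𝕜 k + β k • fFun 𝕜 k) := by
  obtain ⟨hf, hL⟩ := h
  have hA := hf.angularIntegrable
  refine exists_eq_sum_of_circleCoeff hA fun T k hk => ?_
  refine circleCoeff_eq_zero_of_lplus (hA.clm_comp T) (m := m) (fun φ => ?_) (by simpa using hk)
  rw [← hA.map_lplus T m φ, ← opLplus_eq, hL, map_zero]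

theorem exists_eq_sum_of_mem_nullLminus {m : ℕ} {f : ℝ →ₘ[volume] 𝕜} (h : f ∈ nullLminus 𝕜 m) :
    ∃ α β : ℕ → 𝕜, f = ∑ k ∈ Finset.range (m + 1), (α k • gFun 𝕜 k + β k • fFun 𝕜 k) := by
  obtain ⟨hf, hL⟩ := h
  have hA := hf.angularIntegrable
  refine exists_eq_sum_of_circleCoeff hA fun T k hk => ?_
  refine circleCoeff_eq_zero_of_lminus (hA.clm_comp T) (m := m) (fun φ => ?_)
    (by simpa [Nat.lt_succ_iff] using hk)
  rw [← hA.map_lminus T m φ, ← opLminus_eq, hL, map_zero]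

theorem nullLplus_eq_span (m : ℕ) :
    nullLplus 𝕜 m = (Submodule.span 𝕜 {fFun 𝕜 m, gFun 𝕜 m} : Submodule 𝕜 (ℝ →ₘ[volume] 𝕜)) := by
  apply Set.Subset.antisymm
  · intro f hf
    obtain ⟨α, β, hαβ⟩ := exists_eq_sum_of_mem_nullLplus hf
    rw [hαβ, Finset.sum_singleton]
    exact add_mem (Submodule.smul_mem _ _ (Submodule.subset_span (by simp)))
      (Submodule.smul_mem _ _ (Submodule.subset_span (by simp)))
  · intro f hf
    refine span_subset_of_generators (L := fun F => lplus m F)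
      (fun hF hG φ => lplus_add hF hG m φ) (fun hF T φ => hF.map_lplus T m φ)
      (fun h φ => lplus_congr h m φ) (fun g hg => ?_) hf
    have hz : ∀ (T : ℂ →L[ℝ] 𝕜) φ, lplus m (fun x => T (stereo x ^ m)) φ = 0 := by
      intro T φ
      rw [← (angularIntegrable_stereo_pow m).map_lplus T, lplus_stereo_pow, sub_self, zero_mul,
        map_zero]
    rcases hg with rfl | rfl
    · exact ⟨_, stereoLipschitz_clm (imMap 𝕜) m, coeFn_fFun m, hz _⟩
    · exact ⟨_, stereoLipschitz_clm (reMap 𝕜) m, coeFn_gFun m, hz _⟩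

theorem nullLminus_eq_span (m : ℕ) :
    nullLminus 𝕜 m = (Submodule.span 𝕜 ({AEEqFun.const ℝ (1 : 𝕜)} ∪
        fFun 𝕜 '' Set.Icc 1 m ∪ gFun 𝕜 '' Set.Icc 1 m) : Submodule 𝕜 (ℝ →ₘ[volume] 𝕜)) := by
  apply Set.Subset.antisymm
  · intro f hf
    obtain ⟨α, β, hαβ⟩ := exists_eq_sum_of_mem_nullLminus hf
    rw [hαβ]
    refine sum_mem fun k hk => ?_
    rw [Finset.mem_range] at hk
    rcases Nat.eq_zero_or_pos k with rfl | hk0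
    · rw [gFun_zero, smul_fFun_zero, add_zero]
      exact Submodule.smul_mem _ _ (Submodule.subset_span (Or.inl (Or.inl rfl)))
    · have hk' : k ∈ Set.Icc 1 m := ⟨hk0, by omega⟩
      exact add_mem
        (Submodule.smul_mem _ _ (Submodule.subset_span (Or.inr (Set.mem_image_of_mem _ hk'))))
        (Submodule.smul_mem _ _
          (Submodule.subset_span (Or.inl (Or.inr (Set.mem_image_of_mem _ hk')))))
  · intro f hf
    refine span_subset_of_generators (L := fun F => lminus m F)
      (fun hF hG φ => lminus_add hF hG m φ) (fun hF T φ => hF.map_lminus T m φ)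
      (fun h φ => lminus_congr h m φ) (fun g hg => ?_) hf
    have hz : ∀ k ≤ m, ∀ (T : ℂ →L[ℝ] 𝕜) φ, lminus m (fun x => T (stereo x ^ k)) φ = 0 := by
      intro k hk T φ
      rw [← (angularIntegrable_stereo_pow k).map_lminus T, lminus_stereo_pow, Nat.cast_sub hk]
      simp
    rcases hg with (hg | ⟨k, hk, rfl⟩) | ⟨k, hk, rfl⟩
    · rw [Set.mem_singleton_iff] at hg
      rw [hg, ← gFun_zero]
      exact ⟨_, stereoLipschitz_clm (reMap 𝕜) 0, coeFn_gFun 0, hz 0 (Nat.zero_le m) _⟩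
    · exact ⟨_, stereoLipschitz_clm (imMap 𝕜) k, coeFn_fFun k, hz k hk.2 _⟩
    · exact ⟨_, stereoLipschitz_clm (reMap 𝕜) k, coeFn_gFun k, hz k hk.2 _⟩

/-! ### Dimensions -/

theorem finrank_span_nullLplus {m : ℕ} (hm : 1 ≤ m) :
    Module.finrank 𝕜 (Submodule.span 𝕜 (nullLplus 𝕜 m)) = 2 := by
  rw [nullLplus_eq_span, Submodule.span_eq]
  have hli : LinearIndependent 𝕜 ![fFun 𝕜 m, gFun 𝕜 m] := by
    refine LinearIndependent.pair_iff.2 fun s t hst => ?_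
    have := eq_zero_of_sum_eq_zero (S := {m}) (α := fun _ => t) (β := fun _ => s)
      (by rw [Finset.sum_singleton, add_comm]; exact hst) (Finset.mem_singleton_self m)
    exact ⟨this.2 (by omega), this.1⟩
  have := finrank_span_eq_card hli
  rwa [show Set.range ![fFun 𝕜 m, gFun 𝕜 m] = {fFun 𝕜 m, gFun 𝕜 m} by
    ext f; simp [or_comm], Fintype.card_fin] at this

theorem finrank_span_nullLminus (m : ℕ) :
    Module.finrank 𝕜 (Submodule.span 𝕜 (nullLminus 𝕜 m)) = 2 * m + 1 := by
  rw [nullLminus_eq_span, Submodule.span_eq]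
  -- The cosines start at frequency 0, which gives the constant 1; the sines are shifted to start at
  -- 1, because sin 0 = 0.
  set b : Fin (m + 1) ⊕ Fin m → (ℝ →ₘ[volume] 𝕜) :=
    Sum.elim (fun k => gFun 𝕜 k) fun k => fFun 𝕜 (k + 1) with hb
  have hli : LinearIndependent 𝕜 b := by
    refine Fintype.linearIndependent_iff.2 fun c hc => ?_
    set α : ℕ → 𝕜 := fun k => if h : k < m + 1 then c (Sum.inl ⟨k, h⟩) else 0 with hα
    set β : ℕ → 𝕜 := fun k => if h : k - 1 < m then c (Sum.inr ⟨k - 1, h⟩) else 0 with hβ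
    have hsum : ∑ k ∈ Finset.range (m + 1), (α k • gFun 𝕜 k + β k • fFun 𝕜 k) = 0 := by
      rw [← hc, Fintype.sum_sum_type, Finset.sum_add_distrib, Finset.sum_range_succ' (fun k =>
        β k • fFun 𝕜 k), smul_fFun_zero, add_zero, Finset.sum_range, Finset.sum_range]
      congr 1
      · refine Finset.sum_congr rfl fun k _ => ?_
        simp only [hα, hb, dif_pos k.2, Sum.elim_inl]
      · refine Finset.sum_congr rfl fun k _ => ?_
        simp [hβ, hb, k.2]
    rintro (k | k)
    · have := (eq_zero_of_sum_eq_zero hsum (Finset.mem_range.2 k.2)).1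
      simp only [hα, dif_pos k.2] at this
      exact this
    · have := (eq_zero_of_sum_eq_zero hsum (k := k + 1)
        (Finset.mem_range.2 (by omega))).2 (Nat.succ_ne_zero _)
      simpa [hβ, k.2] using this
  have hrange : Set.range b = {AEEqFun.const ℝ (1 : 𝕜)} ∪
      fFun 𝕜 '' Set.Icc 1 m ∪ gFun 𝕜 '' Set.Icc 1 m := by
    rw [hb, Set.Sum.elim_range]
    ext f
    constructor
    · rintro (⟨k, rfl⟩ | ⟨k, rfl⟩)
      · rcases Nat.eq_zero_or_pos (k : ℕ) with hk | hk
        · left; left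
          simp only [hk]
          exact gFun_zero
        · exact Or.inr ⟨k, ⟨hk, by omega⟩, rfl⟩
      · exact Or.inl (Or.inr ⟨k + 1, ⟨by omega, by omega⟩, rfl⟩)
    · rintro ((hf | ⟨k, hk, rfl⟩) | ⟨k, hk, rfl⟩)
      · rw [Set.mem_singleton_iff] at hf
        exact Or.inl ⟨0, by rw [hf, ← gFun_zero]; rfl⟩
      · obtain ⟨h1, h2⟩ := hk
        refine Or.inr ⟨⟨k - 1, by omega⟩, ?_⟩
        simp only [Nat.sub_add_cancel h1]
      · exact Or.inl ⟨⟨k, by have := hk.2; omega⟩, rfl⟩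
  have := finrank_span_eq_card hli
  rw [hrange] at this
  rw [this]
  simp
  ring

/-! ### Resonances -/

theorem not_memLp_two_of_tendsto {f : ℝ → 𝕜} {c : 𝕜} (hc : c ≠ 0)
    (h : Tendsto f atTop (𝓝 c)) : ¬ MemLp f 2 volume := by
  intro hf
  have hi : Integrable fun x => ‖f x‖ ^ 2 := (memLp_two_iff_integrable_sq_norm hf.1).1 hf
  have hlim : Tendsto (fun x => ‖f x‖ ^ 2) atTop (𝓝 (‖c‖ ^ 2)) := h.norm.pow 2
  have hpos : 0 < ‖c‖ ^ 2 := by positivity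
  obtain ⟨a, ha⟩ := eventually_atTop.1 (hlim.eventually (lt_mem_nhds (half_lt_self hpos)))
  have hfin := hi.measure_ge_lt_top (half_pos hpos)
  have hsub : Set.Ici a ⊆ {x | ‖c‖ ^ 2 / 2 ≤ ‖f x‖ ^ 2} := fun x hx => (ha x hx).le
  have := (measure_mono hsub).trans_lt hfin
  simp at this

theorem not_memLp_two_resonance (m : ℕ) :
    ¬ MemLp (if Odd m then fFun 𝕜 m else gFun 𝕜 m : ℝ →ₘ[volume] 𝕜) 2 volume := by
  have hlim : Tendsto (fun x => stereo x ^ m) atTop (𝓝 (I ^ m)) :=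
    (tendsto_stereo atTop_le_cocompact).pow m
  have hsq : (I ^ m) ^ 2 = (-1) ^ m := by rw [← pow_mul, mul_comm, pow_mul, I_sq]
  have key : ∀ T : ℂ →L[ℝ] 𝕜, T (I ^ m) ≠ 0 → ¬ MemLp (fun x => T (stereo x ^ m)) 2 volume :=
    fun T hT => not_memLp_two_of_tendsto hT ((T.continuous.tendsto _).comp hlim)
  split_ifs with hodd
  · rw [memLp_congr_ae (coeFn_fFun m)]
    refine key (imMap 𝕜) ?_
    have h1 : (I ^ m).im ≠ 0 := by
      intro h0
      rw [hodd.neg_one_pow] at hsq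
      have := congrArg Complex.re hsq
      rw [sq, Complex.mul_re, h0] at this
      simp at this
      nlinarith
    simpa [imMap] using h1
  · rw [memLp_congr_ae (coeFn_gFun m)]
    refine key (reMap 𝕜) ?_
    have h1 : (I ^ m).re ≠ 0 := by
      intro h0
      rw [(Nat.not_odd_iff_even.1 hodd).neg_one_pow] at hsq
      have := congrArg Complex.re hsq
      rw [sq, Complex.mul_re, h0] at this
      simp at this
      nlinarith
    simpa [reMap] using h1

theorem isResonance_lplus (m : ℕ) :
    IsResonance (nullLplus 𝕜 m) (if Odd m then fFun 𝕜 m else gFun 𝕜 m) := by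
  refine ⟨?_, not_memLp_two_resonance m⟩
  rw [nullLplus_eq_span]
  apply Submodule.subset_span
  split_ifs <;> simp

theorem isResonance_lminus {m : ℕ} (hm : 1 ≤ m) :
    IsResonance (nullLminus 𝕜 m) (if Odd m then fFun 𝕜 m else gFun 𝕜 m) := by
  refine ⟨?_, not_memLp_two_resonance m⟩
  rw [nullLminus_eq_span]
  apply Submodule.subset_span
  split_ifs
  · exact Or.inl (Or.inr ⟨m, ⟨hm, le_rfl⟩, rfl⟩)
  · exact Or.inr ⟨m, ⟨hm, le_rfl⟩, rfl⟩

end HalfHarmonic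
end

noncomputable section
namespace HalfHarmonic
open Complex Filter Topology

/-! ### Curves of rotations -/

/-- Velocities at the identity add, so a product of rotations about the three axes realises every
skew-symmetric velocity. -/
theorem hasDerivAt_matrix_mul_of_one {A B : ℝ → Matrix (Fin 3) (Fin 3) ℝ}
    {A' B' : Matrix (Fin 3) (Fin 3) ℝ} (hA0 : A 0 = 1) (hB0 : B 0 = 1)
    (hA : ∀ i j, HasDerivAt (fun t => A t i j) (A' i j) 0)
    (hB : ∀ i j, HasDerivAt (fun t => B t i j) (B' i j) 0) (i j : Fin 3) :
    HasDerivAt (fun t => (A t * B t) i j) ((A' + B') i j) 0 := by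
  simp only [Matrix.mul_apply]
  refine (HasDerivAt.fun_sum fun k _ => (hA i k).mul (hB k j)).congr_deriv ?_
  rw [Finset.sum_add_distrib, hA0, hB0, ← Matrix.mul_apply, ← Matrix.mul_apply, mul_one, one_mul]
  rfl

theorem rotation_mem_aux {M : Matrix (Fin 3) (Fin 3) ℝ} (h1 : M * Mᵀ = 1) (h2 : M.det = 1) :
    M ∈ Matrix.specialOrthogonalGroup (Fin 3) ℝ :=
  Matrix.mem_specialOrthogonalGroup_iff.2 ⟨(Matrix.mem_orthogonalGroup_iff _ _).2 h1, h2⟩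

/-- Rotation about the first axis. -/
def rotX (θ : ℝ) : Matrix.specialOrthogonalGroup (Fin 3) ℝ :=
  ⟨!![1, 0, 0; 0, Real.cos θ, -Real.sin θ; 0, Real.sin θ, Real.cos θ], by
    have h := Real.sin_sq_add_cos_sq θ
    refine rotation_mem_aux ?_ ?_
    · ext i j
      fin_cases i <;> fin_cases j <;>
        simp [Matrix.mul_apply, Fin.sum_univ_three] <;> nlinarith
    · simp [Matrix.det_fin_three]; nlinarith⟩

/-- Rotation about the second axis. -/
def rotY (θ : ℝ) : Matrix.specialOrthogonalGroup (Fin 3) ℝ :=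
  ⟨!![Real.cos θ, 0, Real.sin θ; 0, 1, 0; -Real.sin θ, 0, Real.cos θ], by
    have h := Real.sin_sq_add_cos_sq θ
    refine rotation_mem_aux ?_ ?_
    · ext i j
      fin_cases i <;> fin_cases j <;>
        simp [Matrix.mul_apply, Fin.sum_univ_three] <;> nlinarith
    · simp [Matrix.det_fin_three]; nlinarith⟩

/-- Rotation about the third axis. -/
def rotZ (θ : ℝ) : Matrix.specialOrthogonalGroup (Fin 3) ℝ :=
  ⟨!![Real.cos θ, -Real.sin θ, 0; Real.sin θ, Real.cos θ, 0; 0, 0, 1], by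
    have h := Real.sin_sq_add_cos_sq θ
    refine rotation_mem_aux ?_ ?_
    · ext i j
      fin_cases i <;> fin_cases j <;>
        simp [Matrix.mul_apply, Fin.sum_univ_three] <;> nlinarith
    · simp [Matrix.det_fin_three]; nlinarith⟩

/-- Every skew-symmetric matrix is the velocity of a curve of rotations through the identity. -/
theorem exists_rotation_curve (a b c : ℝ) :
    ∃ ρ : ℝ → Matrix.specialOrthogonalGroup (Fin 3) ℝ, ρ 0 = 1 ∧
      ∀ i j, HasDerivAt (fun t => (ρ t : Matrix (Fin 3) (Fin 3) ℝ) i j)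
        (!![0, c, -a; -c, 0, -b; a, b, 0] i j) 0 := by
  have hs : ∀ r : ℝ, HasDerivAt (fun t => Real.sin (r * t)) r 0 := fun r => by
    have h := ((hasDerivAt_id (0 : ℝ)).const_mul r).sin
    simpa using h
  have hc : ∀ r : ℝ, HasDerivAt (fun t => Real.cos (r * t)) 0 0 := fun r => by
    have h := ((hasDerivAt_id (0 : ℝ)).const_mul r).cos
    simpa using h
  have hX : ∀ i j, HasDerivAt (fun t => (rotX (b * t) : Matrix (Fin 3) (Fin 3) ℝ) i j)
      (!![0, 0, 0; 0, 0, -b; 0, b, 0] i j) 0 := by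
    intro i j
    fin_cases i <;> fin_cases j <;> simp [rotX] <;>
      first | exact hasDerivAt_const _ _ | exact hs b | exact hc b | exact (hs b).neg
  have hY : ∀ i j, HasDerivAt (fun t => (rotY (-a * t) : Matrix (Fin 3) (Fin 3) ℝ) i j)
      (!![0, 0, -a; 0, 0, 0; - -a, 0, 0] i j) 0 := by
    intro i j
    fin_cases i <;> fin_cases j <;> simp only [rotY] <;>
      first | exact hasDerivAt_const _ _ | exact hs _ | exact hc _ | exact (hs _).neg
  have hZ : ∀ i j, HasDerivAt (fun t => (rotZ (-c * t) : Matrix (Fin 3) (Fin 3) ℝ) i j)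
      (!![0, - -c, 0; -c, 0, 0; 0, 0, 0] i j) 0 := by
    intro i j
    fin_cases i <;> fin_cases j <;> simp only [rotZ] <;>
      first | exact hasDerivAt_const _ _ | exact hs _ | exact hc _ | exact (hs _).neg
  have h0 : ∀ r : ℝ, (rotX (r * 0) : Matrix (Fin 3) (Fin 3) ℝ) = 1 ∧
      (rotY (r * 0) : Matrix (Fin 3) (Fin 3) ℝ) = 1 ∧
      (rotZ (r * 0) : Matrix (Fin 3) (Fin 3) ℝ) = 1 := by
    intro r
    refine ⟨?_, ?_, ?_⟩ <;> ext i j <;> fin_cases i <;> fin_cases j <;> simp [rotX, rotY, rotZ]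
  refine ⟨fun t => rotX (b * t) * (rotY (-a * t) * rotZ (-c * t)), ?_, fun i j => ?_⟩
  · apply Subtype.ext
    simp only [Submonoid.coe_mul, (h0 b).1, (h0 (-a)).2.1, (h0 (-c)).2.2, mul_one]
    rfl
  · simp only [Submonoid.coe_mul]
    refine (hasDerivAt_matrix_mul_of_one (h0 b).1
      (by rw [(h0 (-a)).2.1, (h0 (-c)).2.2, mul_one]) hX
      (hasDerivAt_matrix_mul_of_one (h0 (-a)).2.1 (h0 (-c)).2.2 hY hZ) i j).congr_deriv ?_
    fin_cases i <;> fin_cases j <;> simp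

/-! ### Curves of zeros -/

open Polynomial in
theorem exists_fin_prod_of_monic {p : ℂ[X]} (hp : p.Monic) {m : ℕ} (hm : p.natDegree = m) :
    ∃ z : Fin m → ℂ, ∀ y, p.eval y = ∏ k, (y - z k) := by
  have hs := IsAlgClosed.splits p
  have hcard : p.roots.card = m := by rw [← hs.natDegree_eq_card_roots, hm]
  obtain ⟨l, hl⟩ := Quot.exists_rep p.roots
  have hl' : (l : Multiset ℂ) = p.roots := hl
  have hlen : l.length = m := by rw [← hcard, ← hl', Multiset.coe_card]
  subst hlen
  refine ⟨fun k => l.get k, fun y => ?_⟩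
  have h1 := hs.eq_prod_roots_of_monic hp
  conv_lhs => rw [h1, ← hl']
  simp only [Multiset.map_coe, Multiset.prod_coe, Polynomial.eval_list_prod, List.map_map]
  rw [← List.prod_ofFn]
  congr 1
  exact List.ext_getElem (by simp) (by simp)

open Polynomial in
/-- The zeros of `X ^ m + t r(X)` with `deg r < m` move continuously at `t = 0`. -/
theorem exists_zeros_curve {m : ℕ} (hm : 1 ≤ m) {r : ℂ[X]} (hr : r.degree < m) :
    ∃ ζ : ℝ → Fin m → ℂ, (∀ k, ζ 0 k = 0) ∧ (∀ t k, ‖ζ t k‖ < 1) ∧ ContinuousAt ζ 0 ∧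
      ∀ᶠ t in 𝓝 (0 : ℝ), ∀ y : ℂ, ∏ k, (y - ζ t k) = y ^ m + t * r.eval y := by
  have hdeg : ∀ t : ℝ, (C (t : ℂ) * r).degree < m := fun t => by
    rw [Polynomial.degree_lt_iff_coeff_zero] at hr ⊢
    intro j hj
    rw [coeff_C_mul, hr j hj, mul_zero]
  have hex : ∀ t : ℝ, ∃ z : Fin m → ℂ, ∀ y, y ^ m + t * r.eval y = ∏ k, (y - z k) := by
    intro t
    obtain ⟨z, hz⟩ := exists_fin_prod_of_monic (monic_X_pow_add (hdeg t))
      ((natDegree_add_eq_left_of_degree_lt ((hdeg t).trans_eq (degree_X_pow m).symm)).trans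
        (natDegree_X_pow m))
    refine ⟨z, fun y => ?_⟩
    rw [← hz]
    simp
  -- The roots are numbered arbitrarily for each t. This does no harm to continuity at 0, where all
  -- of them tend to the same point.
  choose z hz using hex
  set K := ∑ j ∈ Finset.range m, ‖r.coeff j‖ with hK
  have hK0 : 0 ≤ K := Finset.sum_nonneg fun _ _ => norm_nonneg _
  have hnat : r.natDegree < m := by
    rcases eq_or_ne r 0 with rfl | h0
    · rwa [natDegree_zero]
    · exact (natDegree_lt_iff_degree_lt h0).2 hr
  have hroot : ∀ t k, ‖z t k‖ ^ m = |t| * ‖r.eval (z t k)‖ := by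
    intro t k
    have h0 : z t k ^ m + t * r.eval (z t k) = 0 := by
      rw [hz]
      exact Finset.prod_eq_zero (Finset.mem_univ k) (sub_self _)
    have h1 := eq_neg_of_add_eq_zero_left h0
    rw [← norm_pow, h1, norm_neg, norm_mul, Complex.norm_real, Real.norm_eq_abs]
  -- A root with |z| ≥ 1 would satisfy |z|^m ≤ |t| K |z|^(m-1), hence |z| ≤ |t| K < 1.
  have hlt : ∀ t, |t| * K < 1 → ∀ k, ‖z t k‖ < 1 := by
    intro t ht k
    by_contra! hge
    have h1 : ‖r.eval (z t k)‖ ≤ K * ‖z t k‖ ^ (m - 1) := by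
      rw [eval_eq_sum_range' hnat, hK, Finset.sum_mul]
      refine (norm_sum_le _ _).trans (Finset.sum_le_sum fun j hj => ?_)
      rw [norm_mul, norm_pow]
      rw [Finset.mem_range] at hj
      exact mul_le_mul_of_nonneg_left (pow_le_pow_right₀ hge (by omega)) (norm_nonneg _)
    have h2 : ‖z t k‖ ^ m ≤ |t| * K * ‖z t k‖ ^ (m - 1) := by
      rw [hroot, mul_assoc]
      exact mul_le_mul_of_nonneg_left h1 (abs_nonneg t)
    have hpos : 0 < ‖z t k‖ ^ (m - 1) := by positivity
    have h3 : ‖z t k‖ ^ m = ‖z t k‖ * ‖z t k‖ ^ (m - 1) := by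
      rw [← pow_succ', Nat.sub_add_cancel hm]
    rw [h3] at h2
    linarith [le_of_mul_le_mul_right h2 hpos]
  have hpow : ∀ t, |t| * K < 1 → ∀ k, ‖z t k‖ ^ m ≤ |t| * K := by
    intro t ht k
    rw [hroot]
    refine mul_le_mul_of_nonneg_left ?_ (abs_nonneg t)
    rw [eval_eq_sum_range' hnat, hK]
    refine (norm_sum_le _ _).trans (Finset.sum_le_sum fun j hj => ?_)
    rw [norm_mul, norm_pow]
    exact mul_le_of_le_one_right (norm_nonneg _) (pow_le_one₀ (norm_nonneg _) (hlt t ht k).le)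
  have hlim : Tendsto (fun t : ℝ => |t| * K) (𝓝 0) (𝓝 0) := by
    have : Continuous fun t : ℝ => |t| * K := by fun_prop
    simpa using this.tendsto 0
  have hev : ∀ᶠ t in 𝓝 (0 : ℝ), |t| * K < 1 := hlim.eventually (gt_mem_nhds one_pos)
  have h00 : ∀ k, z 0 k = 0 := by
    intro k
    have := hpow 0 (by simp) k
    rw [abs_zero, zero_mul] at this
    exact norm_eq_zero.1 ((pow_eq_zero_iff (by omega)).1 (le_antisymm this (by positivity)))
  -- For larger t a default value is taken, so that |ζ| < 1 always and i + ζ stays in the upper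
  -- half-plane.
  set ζ : ℝ → Fin m → ℂ := fun t => if |t| * K < 1 then z t else 0 with hζ
  have hζ0 : ∀ k, ζ 0 k = 0 := fun k => by simp [hζ, h00]
  refine ⟨ζ, hζ0, fun t k => ?_, ?_, ?_⟩
  · by_cases ht : |t| * K < 1
    · simp only [hζ, if_pos ht]
      exact hlt t ht k
    · simp [hζ, if_neg ht]
  · refine continuousAt_pi.2 fun k => ?_
    rw [ContinuousAt, hζ0, Metric.tendsto_nhds]
    intro ε hε
    filter_upwards [hev, hlim.eventually (gt_mem_nhds (pow_pos hε m))] with t ht1 ht2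
    rw [dist_zero_right]
    simp only [hζ, if_pos ht1]
    exact lt_of_pow_lt_pow_left₀ m hε.le ((hpow t ht1 k).trans_lt ht2)
  · filter_upwards [hev] with t ht y
    simp only [hζ, if_pos ht]
    exact (hz t y).symm

open Polynomial in
/-- A trigonometric polynomial of degree at most `m` in partial fractions. -/
theorem exists_partial_fraction (m : ℕ) (μ : ℕ → ℂ) :
    ∃ (c : ℂ) (q : ℂ[X]), q.degree < m ∧ ∀ x : ℝ,
      ∑ k ∈ Finset.range (m + 1), μ k * (stereo x)⁻¹ ^ k
        = c + q.eval ((x : ℂ) - I) / ((x : ℂ) - I) ^ m := by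
  set P : ℂ[X] := ∑ k ∈ Finset.range (m + 1), C (μ k) * (X ^ (m - k) * (C (-I) * X + C 2) ^ k)
    with hP
  have hdeg : P.natDegree ≤ m := by
    refine natDegree_sum_le_of_forall_le _ _ fun k hk => ?_
    rw [Finset.mem_range] at hk
    have h1 : (C (-I) * X + C 2 : ℂ[X]).natDegree ≤ 1 := natDegree_linear_le
    refine (natDegree_C_mul_le _ _).trans (natDegree_mul_le.trans ?_)
    have h2 := natDegree_pow_le_of_le k h1
    have h3 := natDegree_X_pow_le (R := ℂ) (m - k)
    omega
  refine ⟨P.coeff m, P.erase m, ?_, fun x => ?_⟩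
  · rw [degree_lt_iff_coeff_zero]
    intro j hj
    rw [coeff_erase]
    split_ifs with h
    · rfl
    · exact coeff_eq_zero_of_natDegree_lt (by omega)
  · have hy := ofReal_sub_I_ne_zero x
    -- On the circle the inverse is the conjugate, here -i + 2/(x - i). The sum over k is thus `P`
    -- evaluated at x - i over (x - i)^m, and the leading coefficient of `P` splits off as the
    -- constant.
    have hinv : (stereo x)⁻¹ = (-I * ((x : ℂ) - I) + 2) / ((x : ℂ) - I) := by
      rw [← conj_stereo, stereo_eq]
      simp only [map_add, map_div₀, conj_I, Complex.conj_ofReal, map_ofNat]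
      rw [← sub_eq_add_neg]
      field_simp
    have hPe : P.eval ((x : ℂ) - I)
        = P.coeff m * ((x : ℂ) - I) ^ m + (P.erase m).eval ((x : ℂ) - I) := by
      conv_lhs => rw [← monomial_add_erase P m]
      rw [eval_add, eval_monomial]
    have : P.coeff m + (P.erase m).eval ((x : ℂ) - I) / ((x : ℂ) - I) ^ m
        = P.eval ((x : ℂ) - I) / ((x : ℂ) - I) ^ m := by
      rw [hPe, add_div, mul_div_cancel_right₀ _ (pow_ne_zero m hy)]
    rw [this, hP, eval_finsetSum, Finset.sum_div]
    refine Finset.sum_congr rfl fun k hk => ?_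
    rw [Finset.mem_range] at hk
    have hsplit : ((x : ℂ) - I) ^ m = ((x : ℂ) - I) ^ (m - k) * ((x : ℂ) - I) ^ k := by
      rw [← pow_add, Nat.sub_add_cancel (by omega)]
    simp only [eval_mul, eval_C, eval_pow, eval_X, eval_add]
    rw [hinv, div_pow, hsplit]
    field_simp

/-! ### Nondegeneracy -/

theorem trigSum_eq_re (S : Finset ℕ) (a b : ℕ → ℝ) (x : ℝ) :
    trigSum S a b x = (∑ k ∈ S, ((a k : ℂ) + b k * I) * (stereo x)⁻¹ ^ k).re := by
  rw [Complex.re_sum]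
  refine Finset.sum_congr rfl fun k _ => ?_
  rw [← conj_stereo, ← map_pow]
  simp [-map_pow]

/-- The curve of Blaschke products with numerator `(X - i) ^ m + t r(X - i)`. -/
theorem hasDerivAt_blaschke {m : ℕ} {ζ : ℝ → Fin m → ℂ} {r : Polynomial ℂ}
    (h : ∀ᶠ t in 𝓝 (0 : ℝ), ∀ y : ℂ, ∏ k, (y - ζ t k) = y ^ m + t * r.eval y) (x : ℝ) :
    HasDerivAt (fun t => blaschke (fun k => I + ζ t k) x)
      ((((x : ℂ) - I) / (x + I)) ^ m
        * (2 * I * ((r.eval ((x : ℂ) - I) / ((x : ℂ) - I) ^ m).im : ℂ))) 0 := by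
  set y : ℂ := (x : ℂ) - I with hy
  set v : ℂ := r.eval y
  have hy0 : y ≠ 0 := ofReal_sub_I_ne_zero x
  have hyc : (starRingEnd ℂ) y = x + I := by simp [hy]
  have hyc0 : (x : ℂ) + I ≠ 0 := ofReal_add_I_ne_zero x
  -- For real x the denominator is the conjugate of the numerator, so the curve is differentiable in
  -- t even though the individual zeros need not be.
  have heq : (fun t => blaschke (fun k => I + ζ t k) x) =ᶠ[𝓝 0]
      fun t : ℝ => (y ^ m + t * v) / ((x + I) ^ m + t * (starRingEnd ℂ) v) := by
    filter_upwards [h] with t ht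
    have h1 : ∏ k, ((x : ℂ) - (I + ζ t k)) = y ^ m + t * v := by
      rw [← ht y]
      refine Finset.prod_congr rfl fun k _ => ?_
      rw [hy]; ring
    have h2 : ∏ k, ((x : ℂ) - (starRingEnd ℂ) (I + ζ t k))
        = (x + I) ^ m + t * (starRingEnd ℂ) v := by
      have := congrArg (starRingEnd ℂ) h1
      rw [map_prod] at this
      simpa [hyc] using this
    rw [blaschke, Finset.prod_div_distrib, h1, h2]
  refine HasDerivAt.congr_of_eventuallyEq ?_ heq
  have hlin : ∀ a b : ℂ, HasDerivAt (fun t : ℝ => a + t * b) b 0 := fun a b => by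
    simpa using ((HasDerivAt.ofReal_comp (hasDerivAt_id (0 : ℝ))).mul_const b).const_add a
  have hd := (hlin (y ^ m) v).div (hlin ((x + I) ^ m) ((starRingEnd ℂ) v))
    (by simpa using pow_ne_zero m hyc0)
  refine hd.congr_deriv ?_
  have him : (2 * I * ((v / y ^ m).im : ℂ)) = v / y ^ m - (starRingEnd ℂ) v / (x + I) ^ m := by
    rw [← hyc, ← map_pow, ← map_div₀, Complex.sub_conj]
    push_cast
    ring
  rw [him]
  have h1 := pow_ne_zero m hy0
  have h2 := pow_ne_zero m hyc0
  rw [div_pow]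
  simp only [ofReal_zero, zero_mul, add_zero]
  field_simp

/-- Product rule: the horizontal block of the skew matrix acts on the equator as multiplication by
-ic, and its third row gives the vertical component. -/
theorem hasDerivAt_rotate_equator {ρ : ℝ → Matrix.specialOrthogonalGroup (Fin 3) ℝ}
    {a b c : ℝ} (h0 : ρ 0 = 1)
    (hρ : ∀ i j, HasDerivAt (fun t => (ρ t : Matrix (Fin 3) (Fin 3) ℝ) i j)
        (!![0, c, -a; -c, 0, -b; a, b, 0] i j) 0)
    {B : ℝ → ℂ} {B' : ℂ} (hB : HasDerivAt B B' 0) :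
    HasDerivAt (fun t => rotate (ρ t) (equator (B t)))
      (equator (B' - c * I * B 0) + (a * (B 0).re + b * (B 0).im) • frameE) 0 := by
  have hre : HasDerivAt (fun t => (B t).re) B'.re 0 := Complex.reCLM.hasFDerivAt.comp_hasDerivAt 0 hB
  have him : HasDerivAt (fun t => (B t).im) B'.im 0 := Complex.imCLM.hasFDerivAt.comp_hasDerivAt 0 hB
  set v' : Fin 3 → ℝ := ![B'.re + c * (B 0).im, B'.im - c * (B 0).re,
    a * (B 0).re + b * (B 0).im] with hv'
  have hpi : HasDerivAt (fun t => (ρ t : Matrix (Fin 3) (Fin 3) ℝ) *ᵥ (equator (B t)).ofLp) v' 0 := by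
    refine hasDerivAt_pi.2 fun i => ?_
    have h1 := (((hρ i 0).mul hre).add ((hρ i 1).mul him))
    refine (h1.congr_of_eventuallyEq (Eventually.of_forall fun t => ?_)).congr_deriv ?_
    · simp [Matrix.mulVec, dotProduct, Fin.sum_univ_three, equator]
    · rw [h0]
      fin_cases i <;> simp [hv']
      ring
  have hL := ((PiLp.continuousLinearEquiv 2 ℝ fun _ : Fin 3 => ℝ).symm :
    (Fin 3 → ℝ) →L[ℝ] EuclideanSpace ℝ (Fin 3)).hasFDerivAt.comp_hasDerivAt 0 hpi
  refine hL.congr_deriv ?_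
  ext i
  fin_cases i <;> simp [hv', equator, frameE]

theorem frameJE_eq (m : ℕ) (x : ℝ) :
    frameJE m x = equator (-I * (((x : ℂ) - I) / (x + I)) ^ m) := by
  unfold frameJE halfHarmonicMap
  ext i
  fin_cases i <;> simp [equator, frameE, crossProduct]

theorem nondegenerate {m : ℕ} (hm : 1 ≤ m) : Nondegenerate m := by
  intro h₁ hh₁ h₂ hh₂
  obtain ⟨α, β, hα⟩ := exists_eq_sum_of_mem_nullLplus hh₁
  obtain ⟨γ, δ, hγ⟩ := exists_eq_sum_of_mem_nullLminus hh₂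
  have e1 : h₁ =ᵐ[volume] trigSum {m} α β := by rw [hα]; exact coeFn_sum_eq_trigSum _ _ _
  have e2 : h₂ =ᵐ[volume] trigSum (Finset.range (m + 1)) γ δ := by
    rw [hγ]; exact coeFn_sum_eq_trigSum _ _ _
  obtain ⟨c, q, hq, hcq⟩ := exists_partial_fraction m fun k => (γ k : ℂ) + δ k * I
  -- Since Im(-iw/2) = -Re(w)/2, the velocity 2i Q Im(r/(x - i)^m) becomes -iQ times Re(q/(x -
  -- i)^m), and -iQ is the direction `frameJE`.
  set r : Polynomial ℂ := Polynomial.C (-I / 2) * q with hr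
  have hrdeg : r.degree < m := by
    rw [Polynomial.degree_lt_iff_coeff_zero] at hq ⊢
    intro j hj
    rw [hr, Polynomial.coeff_C_mul, hq j hj, mul_zero]
  obtain ⟨ζ, hζ0, hζ1, hζc, hζ⟩ := exists_zeros_curve hm hrdeg
  -- Because z^m = i^m Q, this gives h₁ = Re(νQ), which the third row (Re ν, -Im ν, 0) produces. The
  -- third parameter `c.re` spins the equator and adds the constant term of h₂.
  set ν : ℂ := ((α m : ℂ) - β m * I) * I ^ m with hν
  obtain ⟨ρ, hρ0, hρ⟩ := exists_rotation_curve ν.re (-ν.im) c.re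
  refine ⟨ρ, fun t k => I + ζ t k, hρ0, fun i j => (hρ i j).differentiableAt,
    fun k => by simp [hζ0], fun t k => ?_, ?_, ?_⟩
  · have h1 := (abs_le.1 (Complex.abs_im_le_norm (ζ t k))).1
    have h2 := hζ1 t k
    rw [Complex.add_im, Complex.I_im]
    linarith
  · refine continuousAt_pi.2 fun k => ?_
    exact continuousAt_const.add (continuousAt_pi.1 hζc k)
  · filter_upwards [e1, e2] with x hx1 hx2
    have hd := hasDerivAt_rotate_equator hρ0 hρ (hasDerivAt_blaschke hζ x)
    refine hd.congr_deriv ?_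
    set Q : ℂ := (((x : ℂ) - I) / (x + I)) ^ m with hQ
    have hB0 : blaschke (fun k => I + ζ 0 k) x = Q := by
      simp [blaschke, hζ0, hQ, sub_eq_add_neg, div_pow]
    have hs : stereo x ^ m = I ^ m * Q := by rw [stereo_eq_mul, mul_pow]
    have hval1 : h₁ x = ν.re * Q.re + -ν.im * Q.im := by
      rw [hx1]
      have : trigSum {m} α β x = (((α m : ℂ) - β m * I) * stereo x ^ m).re := by
        simp [trigSum]
      rw [this, hs, ← mul_assoc, ← hν, Complex.mul_re]
      ring
    have hval2 : h₂ x = c.re + (q.eval ((x : ℂ) - I) / ((x : ℂ) - I) ^ m).re := by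
      rw [hx2, trigSum_eq_re, hcq, Complex.add_re]
    have him : (r.eval ((x : ℂ) - I) / ((x : ℂ) - I) ^ m).im
        = -(q.eval ((x : ℂ) - I) / ((x : ℂ) - I) ^ m).re / 2 := by
      rw [hr, Polynomial.eval_mul, Polynomial.eval_C, mul_div_assoc]
      have : ∀ w : ℂ, (-I / 2 * w).im = -w.re / 2 := fun w => by
        simp [Complex.mul_im]
        ring
      exact this _
    rw [hB0, him, ← hval1, frameJE_eq, ← hQ, add_comm]
    congr 1
    have hlin : ∀ (s : ℝ) (w : ℂ), s • equator w = equator (s * w) := fun s w => by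
      ext i
      fin_cases i <;> simp [equator]
    rw [hlin, hval2]
    congr 1
    push_cast
    ring

end HalfHarmonic
end

theorem theorem3p2 {𝕜 : Type*} [RCLike 𝕜] (m : ℕ) (hm : 1 ≤ m) :
    nullLplus 𝕜 m = (Submodule.span 𝕜 {fFun 𝕜 m, gFun 𝕜 m} : Submodule 𝕜 (ℝ →ₘ[volume] 𝕜)) ∧
    nullLminus 𝕜 m = (Submodule.span 𝕜 ({AEEqFun.const ℝ (1 : 𝕜)} ∪
        fFun 𝕜 '' Set.Icc 1 m ∪ gFun 𝕜 '' Set.Icc 1 m) : Submodule 𝕜 (ℝ →ₘ[volume] 𝕜)) ∧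
    Module.finrank 𝕜 (Submodule.span 𝕜 (nullLplus 𝕜 m)) = 2 ∧
    Module.finrank 𝕜 (Submodule.span 𝕜 (nullLminus 𝕜 m)) = 2 * m + 1 ∧
    Nondegenerate m ∧
    IsResonance (nullLplus 𝕜 m) (if Odd m then fFun 𝕜 m else gFun 𝕜 m) ∧
    IsResonance (nullLminus 𝕜 m) (if Odd m then fFun 𝕜 m else gFun 𝕜 m) := by
  exact ⟨nullLplus_eq_span m, nullLminus_eq_span m, finrank_span_nullLplus hm,
    finrank_span_nullLminus m, nondegenerate hm, isResonance_lplus m, isResonance_lminus hm⟩
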